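/- All graphs are finite and simple. For graphs $G$ and $H$, an $H$-model in $G$ is a family $(T_v)_{v\in V(H)}$ of pairwise vertex-disjoint subgraphs of $G$, each of which is a tree, such that for every edge $uv\in E(H)$ there is at least one edge of $G$ joining a vertex of $T_u$ to a vertex of $T_v$. The model is odd if its vertices (the vertices of $\bigcup_{v\in V(H)} T_v$) can be coloured with two colours so that every edge of every tree $T_v$ has ends of different colours and, for every edge $uv\in E(H)$, there is an edge of $G$ joining a vertex of $T_u$ to a vertex of $T_v$ whose two ends have the same colour. $H$ is an odd minor of $G$ if there is an odd $H$-model in $G$. Let $\alpha(G)$ and $\chi(G)$ denote the independence number and the chromatic number of $G$, and $K_{m,n}$ the complete bipartite graph with parts of sizes $m$ and $n$. Theorem. Let $G$ be a graph with $\alpha(G)\le 2$. Then for every integer $\ell$ with $1\le \ell<\chi(G)$, $G$ contains $K_{\ell,\,\chi(G)-\ell}$ as an odd minor. -/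

import Mathlib

namespace SimpleGraph

/-- An `H`-model in `G`: vertex-disjoint subgraphs `T w` of `G` (the branch sets), one for every
vertex `w` of `H`, each of which is a tree, such that for every edge `uv` of `H` some edge of `G`
joins a vertex of `T u` to a vertex of `T v`. -/
structure IsModel {V W : Type*} (H : SimpleGraph W) (G : SimpleGraph V) (T : W → G.Subgraph) :
    Prop where
  isTree : ∀ w, (T w).coe.IsTree
  disjoint : ∀ u v, u ≠ v → Disjoint (T u).verts (T v).verts
  exists_adj : ∀ u v, H.Adj u v → ∃ x ∈ (T u).verts, ∃ y ∈ (T v).verts, G.Adj x y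

/-- An `H`-model is odd if its vertices can be coloured with two colours such that every edge of
every branch set is bichromatic, and every edge `uv` of `H` is represented by a monochromatic edge
of `G` between `T u` and `T v`. (Only the values of the colouring on the branch sets matter.) -/
structure IsOddModel {V W : Type*} (H : SimpleGraph W) (G : SimpleGraph V) (T : W → G.Subgraph) :
    Prop extends IsModel H G T where
  exists_coloring : ∃ c : V → Bool,
    (∀ w x y, (T w).Adj x y → c x ≠ c y) ∧
    ∀ u v, H.Adj u v → ∃ x ∈ (T u).verts, ∃ y ∈ (T v).verts, G.Adj x y ∧ c x = c y

/-- `H` is an odd minor of `G`: there is an odd `H`-model in `G`. -/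
def IsOddMinor {V W : Type*} (H : SimpleGraph W) (G : SimpleGraph V) : Prop :=
  ∃ T : W → G.Subgraph, IsOddModel H G T

end SimpleGraph

/-! Let `H` be the complement of `G`. It is triangle-free because α(G) ≤ 2, so colour classes of `G`
are vertices and edges of `H`, and χ(G) = k means that a maximum matching of `H` misses `e` of the
`n` vertices, where n + e = 2k. By symmetry 2ℓ ≤ k. Deleting vertices as long as `k` survives, one
may assume that every vertex is missed by some maximum matching. Then Gallai's lemma
(`IsMatchingCritical.eq_of_reachable`) says that a maximum matching misses at most one vertex of
each component.

The `k - ℓ` branch sets on one side are single vertices, the `ℓ` on the other are single vertices or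
stars. No vertex is `H`-adjacent to both ends of an edge of `H`; so a star of `G` whose leaves are
the ends of an edge of `H` reaches every further vertex through a leaf, and giving the centres of
such stars a colour of their own makes the model odd. Two matching edges with at most one edge of
`H` between them (a link) contain such a star, a "seagull", and leave a fourth vertex for the other
side. If a maximum matching has `ℓ - e` disjoint links, the missed vertices and the seagulls give
the `ℓ` branch sets, and a suitable end of every remaining matching edge helps to fill the other
side (`IsLinkage.hasStarModel`).

Otherwise take a maximum matching `σ` and a set of links on it, as many as possible. The matching
edges outside the links pairwise span four-cycles of `H`, so they form a complete bipartite graph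
with sides `A` and `σ A`. These sides extend to independent sets `X ⊇ A` and `Y = σ X` such that
every link has an edge between them. A matching of `H`-nonadjacent pairs between `X` and `Y` that is
larger than the set of links between them could be exchanged for these links
(`IsLinkage.card_ne_of_maximal`). So by Hall's theorem (`exists_matching_or_unrelated`) large
subsets of `X` and `Y` are completely joined in `H`. Each vertex has no `H`-neighbour in one of the
two subsets; counting with Gallai's lemma, one of them is missed by `k` vertices, and `K_{ℓ,k-ℓ}` is
even a subgraph of `G` (`IsMatchingCritical.hasStarModel_of_complete`). -/

namespace SimpleGraph

/-! ### Star models and the odd minors they provide -/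

/-- The star with centre `c` and leaves `S`, as a subgraph of `G`. -/
def starSubgraph {V : Type*} (G : SimpleGraph V) (c : V) (S : Finset V)
    (h : ∀ s ∈ S, G.Adj c s) : G.Subgraph where
  verts := {v | v = c ∨ v ∈ S}
  Adj x y := (x = c ∧ y ∈ S) ∨ (y = c ∧ x ∈ S)
  adj_sub := by
    rintro x y (⟨rfl, hy⟩ | ⟨rfl, hx⟩)
    · exact h y hy
    · exact (h x hx).symm
  edge_vert := by
    rintro x y (⟨rfl, hy⟩ | ⟨rfl, hx⟩)
    · exact Or.inl rfl
    · exact Or.inr hx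
  symm := ⟨fun _ _ h => h.symm⟩

theorem isTree_starSubgraph {V : Type*} (G : SimpleGraph V) (c : V) (S : Finset V)
    (h : ∀ s ∈ S, G.Adj c s) : (G.starSubgraph c S h).coe.IsTree := by
  have hc : c ∉ S := fun hc => G.loopless.irrefl c (h c hc)
  have : (G.starSubgraph c S h).coe = starGraph ⟨c, Or.inl rfl⟩ := by
    ext ⟨x, hx⟩ ⟨y, hy⟩
    rw [starGraph_adj]
    simp only [starSubgraph, Subgraph.coe_adj, ne_eq]
    rcases hx with rfl | hx <;> rcases hy with rfl | hy
    · simp [hc]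
    · simp only [hy]
      have : x ≠ y := fun e => hc (e ▸ hy)
      simp [this]
    · have : x ≠ y := fun e => hc (e ▸ hx)
      simp [this, hx]
    · have hx' : x ≠ c := fun e => hc (e ▸ hx)
      have hy' : y ≠ c := fun e => hc (e ▸ hy)
      simp [hx', hy']
  rw [this]
  exact isTree_starGraph _

/-- Disjoint stars (possibly single vertices) and a disjoint set `B` of single vertices such that
every vertex of `B` is adjacent to a leaf of every star, or to its centre if it has no leaves. -/
structure IsStarModel {V ι : Type*} (G : SimpleGraph V) (c : ι → V) (S : ι → Finset V)
    (B : Finset V) : Prop where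
  adj : ∀ i, ∀ s ∈ S i, G.Adj (c i) s
  disjoint : ∀ i j v, (v = c i ∨ v ∈ S i) → (v = c j ∨ v ∈ S j) → i = j
  notMem : ∀ i v, (v = c i ∨ v ∈ S i) → v ∉ B
  dom : ∀ i, ∀ b ∈ B, (∃ s ∈ S i, G.Adj s b) ∨ (S i = ∅ ∧ G.Adj (c i) b)

/-- `G` has a star model with `ℓ` stars and `r` further single vertices. -/
def HasStarModel {V : Type*} (G : SimpleGraph V) (ℓ r : ℕ) : Prop :=
  ∃ (c : Fin ℓ → V) (S : Fin ℓ → Finset V) (B : Finset V), B.card = r ∧ IsStarModel G c S B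

theorem IsStarModel.hasStarModel {V ι : Type*} [Fintype ι] {G : SimpleGraph V} {c : ι → V}
    {S : ι → Finset V} {B : Finset V} (h : IsStarModel G c S B) {ℓ r : ℕ}
    (hι : Fintype.card ι = ℓ) (hr : r ≤ B.card) : HasStarModel G ℓ r := by
  obtain ⟨B', hB', hcard⟩ := Finset.exists_subset_card_eq hr
  let f := (Fintype.equivFinOfCardEq hι).symm
  refine ⟨c ∘ f, S ∘ f, B', hcard, ⟨fun i => h.adj (f i), fun i j v hi hj => ?_,
    fun i v hv hB => h.notMem (f i) v hv (hB' hB), fun i b hb => h.dom (f i) b (hB' hb)⟩⟩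
  exact f.injective (h.disjoint _ _ v hi hj)

theorem HasStarModel.map {V W : Type*} {G : SimpleGraph V} {G' : SimpleGraph W} {ℓ r : ℕ}
    (h : HasStarModel G ℓ r) (f : G ↪g G') : HasStarModel G' ℓ r := by
  obtain ⟨c, S, B, hB, h⟩ := h
  have key : ∀ i v, (v = f (c i) ∨ v ∈ (S i).map f.toEmbedding) →
      ∃ w, f w = v ∧ (w = c i ∨ w ∈ S i) := by
    intro i v hv
    rcases hv with rfl | hv
    · exact ⟨c i, rfl, Or.inl rfl⟩
    · obtain ⟨w, hw, rfl⟩ := Finset.mem_map.1 hv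
      exact ⟨w, rfl, Or.inr hw⟩
  refine ⟨f ∘ c, fun i => (S i).map f.toEmbedding, B.map f.toEmbedding, by simpa using hB,
    ⟨?_, ?_, ?_, ?_⟩⟩
  · intro i s hs
    obtain ⟨w, hw, rfl⟩ := Finset.mem_map.1 hs
    exact f.map_adj_iff.2 (h.adj i w hw)
  · intro i j v hi hj
    obtain ⟨w, rfl, hw⟩ := key i v hi
    obtain ⟨w', hw', hj'⟩ := key j _ hj
    obtain rfl := f.injective hw'
    exact h.disjoint i j _ hw hj'
  · intro i v hv hB
    obtain ⟨w, rfl, hw⟩ := key i v hv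
    obtain ⟨w', hw', h'⟩ := Finset.mem_map.1 hB
    obtain rfl := f.injective h'
    exact h.notMem i _ hw hw'
  · intro i b hb
    obtain ⟨w, hw, rfl⟩ := Finset.mem_map.1 hb
    rcases h.dom i w hw with ⟨s, hs, hsw⟩ | ⟨hS, hcw⟩
    · exact Or.inl ⟨f s, Finset.mem_map_of_mem _ hs, f.map_adj_iff.2 hsw⟩
    · refine Or.inr ⟨by simp [hS], f.map_adj_iff.2 hcw⟩

theorem IsOddMinor.of_iso {V W W' : Type*} {G : SimpleGraph V} {H : SimpleGraph W}
    {H' : SimpleGraph W'} (e : H' ≃g H) (h : IsOddMinor H G) : IsOddMinor H' G := by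
  obtain ⟨T, hT⟩ := h
  obtain ⟨c, hc, hc'⟩ := hT.exists_coloring
  exact ⟨T ∘ e, ⟨⟨fun w => hT.isTree _, fun u v huv => hT.disjoint _ _ (e.injective.ne huv),
    fun u v huv => hT.exists_adj _ _ (e.map_adj_iff.2 huv)⟩,
    c, fun w => hc _, fun u v huv => hc' _ _ (e.map_adj_iff.2 huv)⟩⟩

/-- The centres of stars with at least one leaf get one colour, all other vertices the other. Star
edges are then bichromatic, and the edges to `B` that domination provides start at leaves or at
isolated centres, so they are monochromatic. -/
theorem HasStarModel.isOddMinor {V : Type*} {G : SimpleGraph V} {ℓ r : ℕ}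
    (h : HasStarModel G ℓ r) : IsOddMinor (completeBipartiteGraph (Fin ℓ) (Fin r)) G := by
  classical
  obtain ⟨c, S, B, hB, h⟩ := h
  let z : Fin r → V := fun j => (B.equivFinOfCardEq hB).symm j
  have hz : ∀ j, z j ∈ B := fun j => ((B.equivFinOfCardEq hB).symm j).2
  have hzinj : Function.Injective z :=
    Subtype.val_injective.comp (B.equivFinOfCardEq hB).symm.injective
  let T : Fin ℓ ⊕ Fin r → G.Subgraph := Sum.elim
    (fun i => G.starSubgraph (c i) (S i) (h.adj i)) (fun j => G.starSubgraph (z j) ∅ (by simp))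
  have hTr : ∀ j v, v ∈ (T (Sum.inr j)).verts ↔ v = z j := fun j v => by
    change (v = z j ∨ v ∈ (∅ : Finset V)) ↔ _
    simp
  let col : V → Bool := fun v => decide (∃ i, v = c i ∧ (S i).Nonempty)
  have hcolc : ∀ i, (S i).Nonempty → col (c i) = true := fun i hi =>
    decide_eq_true ⟨i, rfl, hi⟩
  have hcolS : ∀ i, ∀ s ∈ S i, col s = false := by
    intro i s hs
    refine decide_eq_false ?_
    rintro ⟨j, rfl, -⟩
    obtain rfl := h.disjoint i j _ (Or.inr hs) (Or.inl rfl)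
    exact (h.adj i _ hs).ne rfl
  have hcole : ∀ i, S i = ∅ → col (c i) = false := by
    intro i hi
    refine decide_eq_false ?_
    rintro ⟨j, hj, hn⟩
    obtain rfl := h.disjoint i j _ (Or.inl rfl) (Or.inl hj)
    simp [hi] at hn
  have hcolB : ∀ b ∈ B, col b = false := by
    intro b hb
    refine decide_eq_false ?_
    rintro ⟨j, rfl, -⟩
    exact h.notMem j _ (Or.inl rfl) hb
  have key : ∀ i j, ∃ x ∈ (T (Sum.inl i)).verts, ∃ y ∈ (T (Sum.inr j)).verts,
      G.Adj x y ∧ col x = col y := by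
    intro i j
    rcases h.dom i (z j) (hz j) with ⟨s, hs, hsz⟩ | ⟨hS, hcz⟩
    · exact ⟨s, Or.inr hs, z j, (hTr _ _).2 rfl, hsz, by rw [hcolS i s hs, hcolB _ (hz j)]⟩
    · exact ⟨c i, Or.inl rfl, z j, (hTr _ _).2 rfl, hcz, by rw [hcole i hS, hcolB _ (hz j)]⟩
  have hcol : ∀ u v, (completeBipartiteGraph (Fin ℓ) (Fin r)).Adj u v →
      ∃ x ∈ (T u).verts, ∃ y ∈ (T v).verts, G.Adj x y ∧ col x = col y := by
    rintro (i | j) (i' | j') huv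
    · simp at huv
    · exact key i j'
    · obtain ⟨x, hx, y, hy, hxy, he⟩ := key i' j
      exact ⟨y, hy, x, hx, hxy.symm, he.symm⟩
    · simp at huv
  refine ⟨T, ⟨⟨?_, ?_, fun u v huv => ?_⟩, col, ?_, hcol⟩⟩
  · rintro (i | j)
    · exact isTree_starSubgraph G (c i) (S i) (h.adj i)
    · exact isTree_starSubgraph G (z j) ∅ (by simp)
  · intro u v huv
    rw [Set.disjoint_left]
    intro x hu hv
    apply huv
    rcases u with i | j <;> rcases v with i' | j'
    · rw [h.disjoint i i' x hu hv]
    · rw [hTr] at hv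
      exact absurd (hv ▸ hz j') (h.notMem i x hu)
    · rw [hTr] at hu
      exact absurd (hu ▸ hz j) (h.notMem i' x hv)
    · rw [hTr] at hu hv
      rw [hzinj (hu.symm.trans hv)]
  · obtain ⟨x, hx, y, hy, hxy, -⟩ := hcol u v huv
    exact ⟨x, hx, y, hy, hxy⟩
  · rintro (i | j) x y hxy
    · rcases hxy with ⟨rfl, hy⟩ | ⟨rfl, hx⟩
      · rw [hcolc i ⟨y, hy⟩, hcolS i y hy]; simp
      · rw [hcolc i ⟨x, hx⟩, hcolS i x hx]; simp
    · rcases hxy with ⟨_, hy⟩ | ⟨_, hx⟩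
      · simp at hy
      · simp at hx

end SimpleGraph

/-! ### Matchings as involutions, Gallai's lemma, and colourings from matchings -/

namespace SimpleGraph

open Finset Equiv

variable {V : Type*}

/-- `σ` is the involution that swaps the ends of every edge of a matching of `H` and fixes the
vertices that the matching does not cover. -/
structure IsPairing (H : SimpleGraph V) (σ : Perm V) : Prop where
  invol : ∀ v, σ (σ v) = v
  adj : ∀ v, σ v ≠ v → H.Adj v (σ v)

/-- The vertices fixed by `σ`, that is, not covered by the matching. -/
def unmatched [Fintype V] [DecidableEq V] (σ : Perm V) : Finset V :=
  univ.filter fun v => σ v = v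

@[simp]
theorem mem_unmatched [Fintype V] [DecidableEq V] {σ : Perm V} {v : V} :
    v ∈ unmatched σ ↔ σ v = v := by
  simp [unmatched]

theorem IsPairing.even_card_add [Fintype V] [DecidableEq V] {H : SimpleGraph V} {σ : Perm V}
    (h : IsPairing H σ) : Even (Fintype.card V + (unmatched σ).card) := by
  have h2 : 2 ∣ σ.support.card := Perm.two_dvd_card_support (by ext v; simp [sq, h.invol])
  have hs : σ.support = univ \ unmatched σ := by ext v; simp
  have hc := card_sdiff_add_card_eq_card (subset_univ (unmatched σ))
  rw [← hs, card_univ] at hc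
  rw [← hc]
  obtain ⟨a, ha⟩ := h2
  exact ⟨a + (unmatched σ).card, by omega⟩

theorem IsPairing.eq_iff {H : SimpleGraph V} {σ : Perm V} (h : IsPairing H σ) {v w : V} :
    σ v = w ↔ v = σ w := by
  constructor
  · rintro rfl; exact (h.invol v).symm
  · rintro rfl; exact h.invol w

theorem isPairing_one (H : SimpleGraph V) : IsPairing H 1 := ⟨by simp, by simp⟩

/-- Adding an edge between two unmatched vertices. -/
theorem IsPairing.swap_mul [DecidableEq V] {H : SimpleGraph V} {σ : Perm V} (h : IsPairing H σ)
    {x y : V} (hx : σ x = x) (hy : σ y = y) (hxy : H.Adj x y) : IsPairing H (swap x y * σ) := by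
  have key : ∀ v, v ≠ x → v ≠ y → (swap x y * σ) v = σ v := by
    intro v hvx hvy
    rw [Perm.mul_apply, swap_apply_of_ne_of_ne]
    · exact fun e => hvx (by rw [h.eq_iff, hx] at e; exact e)
    · exact fun e => hvy (by rw [h.eq_iff, hy] at e; exact e)
  have kx : (swap x y * σ) x = y := by simp [hx]
  have ky : (swap x y * σ) y = x := by simp [hy]
  constructor
  · intro v
    by_cases hvx : v = x
    · rw [hvx, kx, ky]
    by_cases hvy : v = y
    · rw [hvy, ky, kx]
    rw [key v hvx hvy, key, h.invol]
    · exact fun e => hvx (by rw [h.eq_iff, hx] at e; exact e)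
    · exact fun e => hvy (by rw [h.eq_iff, hy] at e; exact e)
  · intro v hv
    by_cases hvx : v = x
    · rw [hvx, kx]; exact hxy
    by_cases hvy : v = y
    · rw [hvy, ky]; exact hxy.symm
    rw [key v hvx hvy] at hv ⊢
    exact h.adj v hv

theorem IsPairing.card_unmatched_swap_mul [Fintype V] [DecidableEq V] {H : SimpleGraph V}
    {σ : Perm V} {x y : V} (hx : σ x = x) (hy : σ y = y)
    (hxy : H.Adj x y) : (unmatched (swap x y * σ)).card < (unmatched σ).card := by
  apply card_lt_card
  rw [ssubset_iff_of_subset]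
  · exact ⟨x, by simpa using hx, by simpa [hx] using hxy.ne'⟩
  · intro v hv
    rw [mem_unmatched, Perm.mul_apply] at hv
    rw [mem_unmatched]
    by_cases hvx : v = x
    · rw [hvx, hx]
    by_cases hvy : v = y
    · rw [hvy, hy]
    by_cases h1 : σ v = x
    · rw [h1, swap_apply_left] at hv; exact absurd hv.symm hvy
    by_cases h2 : σ v = y
    · rw [h2, swap_apply_right] at hv; exact absurd hv.symm hvx
    rwa [swap_apply_of_ne_of_ne h1 h2] at hv

theorem card_unmatched_conj [Fintype V] [DecidableEq V] (σ : Perm V) (x y : V) :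
    (unmatched (swap x y * σ * swap x y)).card = (unmatched σ).card := by
  apply card_equiv (swap x y)
  intro v
  simp only [mem_unmatched, Perm.mul_apply]
  rw [swap_apply_eq_iff]

theorem conj_apply_of_ne [DecidableEq V] {σ : Perm V} {x y v : V} (h1 : v ≠ x) (h2 : v ≠ y)
    (h3 : σ v ≠ x) (h4 : σ v ≠ y) : (swap x y * σ * swap x y) v = σ v := by
  rw [Perm.mul_apply, Perm.mul_apply, swap_apply_of_ne_of_ne h1 h2, swap_apply_of_ne_of_ne h3 h4]

/-- The matching obtained by exchanging the roles of `x` and `y`. -/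
theorem IsPairing.conj [DecidableEq V] {H : SimpleGraph V} {σ : Perm V} (h : IsPairing H σ)
    {x y : V} (hxy : σ x ≠ y) (hx : σ x ≠ x → H.Adj (σ x) y) (hy : σ y ≠ y → H.Adj (σ y) x) :
    IsPairing H (swap x y * σ * swap x y) := by
  have hyx : σ y ≠ x := fun e => hxy (by rw [← e, h.invol])
  have kx : (swap x y * σ * swap x y) x = if σ y = y then x else σ y := by
    split_ifs with hh
    · simp [hh]
    · simp [swap_apply_of_ne_of_ne hyx hh]
  have ky : (swap x y * σ * swap x y) y = if σ x = x then y else σ x := by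
    split_ifs with hh
    · simp [hh]
    · simp [swap_apply_of_ne_of_ne hh hxy]
  constructor
  · intro v
    simp [Perm.mul_apply, h.invol]
  · intro v hv
    by_cases hvx : v = x
    · subst hvx
      rw [kx] at hv ⊢
      split_ifs at hv ⊢ with hh
      · exact absurd rfl hv
      · exact (hy hh).symm
    by_cases hvy : v = y
    · subst hvy
      rw [ky] at hv ⊢
      split_ifs at hv ⊢ with hh
      · exact absurd rfl hv
      · exact (hx hh).symm
    by_cases h1 : σ v = x
    · have : (swap x y * σ * swap x y) v = y := by
        simp [swap_apply_of_ne_of_ne hvx hvy, h1]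
      rw [this]
      have h1' : v = σ x := h.eq_iff.1 h1
      rw [h1']
      exact hx (fun e => hvx (h1'.trans e))
    by_cases h2 : σ v = y
    · have : (swap x y * σ * swap x y) v = x := by
        simp [swap_apply_of_ne_of_ne hvx hvy, h2]
      rw [this]
      have h1' : v = σ y := h.eq_iff.1 h2
      rw [h1']
      exact hy (fun e => hvy (h1'.trans e))
    rw [conj_apply_of_ne hvx hvy h1 h2] at hv ⊢
    exact h.adj v hv

/-- A graph in which every vertex is missed by some maximum matching, `e` being the number of
vertices that a maximum matching misses. -/
structure IsMatchingCritical [Fintype V] [DecidableEq V] (H : SimpleGraph V) (e : ℕ) : Prop where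
  le_card : ∀ σ, IsPairing H σ → e ≤ (unmatched σ).card
  exists_fixed : ∀ v, ∃ σ, IsPairing H σ ∧ (unmatched σ).card = e ∧ σ v = v

/-- The key step of Gallai's lemma: missing no two vertices at the same time is transitive. -/
theorem IsMatchingCritical.trans [Fintype V] [DecidableEq V] {H : SimpleGraph V} {e : ℕ}
    (hH : IsMatchingCritical H e) {u t v : V}
    (hut : ∀ σ, IsPairing H σ → (unmatched σ).card = e → σ u = u → σ t = t → u = t)
    (htv : ∀ σ, IsPairing H σ → (unmatched σ).card = e → σ t = t → σ v = v → t = v)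
    (σ : Perm V) (hσ : IsPairing H σ) (hσe : (unmatched σ).card = e) (hu : σ u = u)
    (hv : σ v = v) : u = v := by
  classical
  by_contra huv
  have hσt : σ t ≠ t := fun ht =>
    huv ((hut σ hσ hσe hu ht).trans (htv σ hσ hσe ht hv))
  -- Among the maximum matchings that miss `t`, `τ` agrees with `σ` at as many vertices as possible.
  obtain ⟨τ, hτ, hmax⟩ := exists_max_image
    (univ.filter fun τ : Perm V => IsPairing H τ ∧ (unmatched τ).card = e ∧ τ t = t)
    (fun τ => (univ.filter fun w => σ w = τ w).card) (by
      obtain ⟨τ, h⟩ := hH.exists_fixed t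
      exact ⟨τ, by simpa using h⟩)
  simp only [mem_filter, mem_univ, true_and] at hτ hmax
  obtain ⟨hτ, hτe, hτt⟩ := hτ
  have hτu : τ u ≠ u := fun hh => hσt (by rw [← hut τ hτ hτe hh hτt]; exact hu)
  have hτv : τ v ≠ v := fun hh => hσt (by rw [htv τ hτ hτe hτt hh]; exact hv)
  have hcard : 2 ≤ (unmatched τ \ unmatched σ).card := by
    have h1 : ({u, v} : Finset V) ⊆ unmatched σ \ unmatched τ := by
      intro w hw
      rcases mem_insert.1 hw with rfl | hw
      · simp [hu, hτu]
      · rw [mem_singleton.1 hw]; simp [hv, hτv]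
    have h2 := card_le_card h1
    rw [card_pair huv] at h2
    have h3 := card_sdiff_add_card_inter (unmatched τ) (unmatched σ)
    have h4 := card_sdiff_add_card_inter (unmatched σ) (unmatched τ)
    rw [inter_comm] at h4
    omega
  -- Both matchings miss `e` vertices and `u`, `v` are missed by `σ` only, so at least two vertices
  -- are missed by `τ` only. One of them is not `t`.
  obtain ⟨x, hx, hxt⟩ := exists_mem_ne (lt_of_lt_of_le one_lt_two hcard) t
  simp only [mem_sdiff, mem_unmatched] at hx
  obtain ⟨hτx, hσx⟩ := hx
  set y := σ x with hy
  have hxy : H.Adj x y := hσ.adj x hσx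
  have hσy : σ y = x := hσ.invol x
  have hτy : τ y ≠ y := by
    intro hh
    have h1 := IsPairing.card_unmatched_swap_mul hτx hh hxy
    have h2 := hH.le_card _ (hτ.swap_mul hτx hh hxy)
    omega
  set z := τ y with hz
  have hτz : τ z = y := hτ.invol y
  have hzx : z ≠ x := fun e => hσx (by rw [← hτz, e, hτx])
  have hty : t ≠ y := fun e => hτy (by rw [hz, ← e, hτt])
  have htz : t ≠ z := fun e => hτy (by rw [← hτz, ← e, hτt])
  -- Replacing the edge `y z` of `τ` by the edge `x y` of `σ` still misses `t`, and it increases the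
  -- agreement with `σ`.
  have hρ : IsPairing H (swap x z * τ * swap x z) := by
    refine hτ.conj (fun e => hzx (by rw [← e, hτx])) (fun e => absurd hτx e) (fun _ => ?_)
    rw [hτz]; exact hxy.symm
  have hρx : (swap x z * τ * swap x z) x = y := by
    simp [hτz, swap_apply_of_ne_of_ne hσx hτy.symm]
  have hρy : (swap x z * τ * swap x z) y = x := by
    rw [hρ.eq_iff, hρx]
  have hρt : (swap x z * τ * swap x z) t = t := by
    rw [conj_apply_of_ne hxt.symm htz, hτt] <;> rw [hτt]
    · exact hxt.symm
    · exact htz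
  have := hmax _ ⟨hρ, by rw [card_unmatched_conj, hτe], hρt⟩
  revert this
  rw [imp_false, not_le]
  apply card_lt_card
  rw [ssubset_iff_of_subset]
  · refine ⟨x, mem_filter.2 ⟨mem_univ _, hρx.symm⟩, ?_⟩
    simp only [mem_filter, mem_univ, true_and, hτx]
    exact hσx
  · intro w hw
    simp only [mem_filter, mem_univ, true_and] at hw ⊢
    have hwx : w ≠ x := fun e => hσx (by rw [hy, ← e, hw, e, hτx])
    have hwy : w ≠ y := fun e => hzx (by rw [hz, ← hσy, ← e, hw])
    have hwz : w ≠ z := by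
      intro e
      rw [e, hτz] at hw
      exact hzx (σ.injective hw)
    rw [conj_apply_of_ne hwx hwz]
    · exact hw
    · exact fun e => hwx (by rw [hτ.eq_iff, hτx] at e; exact e)
    · exact fun e => hwy (by rw [hτ.eq_iff, hτz] at e; exact e)

/-- **Gallai's lemma**: a maximum matching misses at most one vertex of every component. -/
theorem IsMatchingCritical.eq_of_reachable [Fintype V] [DecidableEq V] {H : SimpleGraph V} {e : ℕ}
    (hH : IsMatchingCritical H e) {u v : V} (huv : H.Reachable u v) {σ : Perm V}
    (hσ : IsPairing H σ) (hσe : (unmatched σ).card = e) (hu : σ u = u) (hv : σ v = v) : u = v := by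
  obtain ⟨w⟩ := huv
  induction w generalizing σ with
  | nil => rfl
  | @cons u t v hut p ih =>
    refine hH.trans (t := t) (fun τ hτ hτe h1 h2 => ?_)
      (fun τ hτ hτe h1 h2 => ih hτ hτe h1 h2) σ hσ hσe hu hv
    have h3 := IsPairing.card_unmatched_swap_mul h1 h2 hut
    have h4 := hH.le_card _ (hτ.swap_mul h1 h2 hut)
    omega

/-- The orbits of `σ` are independent in `G`, and twice their number is the order plus the number of
fixed points. Each orbit is represented by its first vertex in some enumeration. -/
theorem IsPairing.colorable [Fintype V] [DecidableEq V] {G : SimpleGraph V} {σ : Perm V}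
    (h : IsPairing Gᶜ σ) {k : ℕ} (hk : Fintype.card V + (unmatched σ).card ≤ 2 * k) :
    G.Colorable k := by
  let f := Fintype.equivFin V
  let I : Finset V := univ.filter fun v => f v ≤ f (σ v)
  have hI : ∀ v, v ∈ I ↔ f v ≤ f (σ v) := fun v => by simp [I]
  have hcard : I.card ≤ k := by
    have h1 : (I.map σ.toEmbedding).card = I.card := card_map _
    have h2 : I ∪ I.map σ.toEmbedding = univ := by
      ext v
      simp only [mem_union, mem_univ, iff_true, hI, mem_map_equiv]
      have : σ.symm v = σ v := by rw [symm_apply_eq, h.invol]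
      rw [this, h.invol]
      exact le_total _ _
    have h3 : I ∩ I.map σ.toEmbedding ⊆ unmatched σ := by
      intro v
      simp only [mem_inter, hI, mem_map_equiv, mem_unmatched]
      have : σ.symm v = σ v := by rw [symm_apply_eq, h.invol]
      rw [this, h.invol]
      rintro ⟨h1, h2⟩
      exact f.injective (le_antisymm h2 h1)
    have h4 := card_union_add_card_inter I (I.map σ.toEmbedding)
    rw [h2, card_univ] at h4
    have h5 := card_le_card h3
    omega
  let c : V → I := fun v => if hv : f v ≤ f (σ v) then ⟨v, (hI v).2 hv⟩ else
    ⟨σ v, (hI _).2 (by rw [h.invol]; exact (not_le.1 hv).le)⟩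
  have hc : ∀ v, (c v : V) = v ∨ (c v : V) = σ v := by
    intro v
    by_cases hv : f v ≤ f (σ v)
    · left; simp [c, hv]
    · right; simp [c, hv]
  have C : G.Coloring I := Coloring.mk c (by
    intro v w hvw e
    have e' : (c v : V) = c w := by rw [e]
    have : w = σ v := by
      rcases hc v with h1 | h1 <;> rcases hc w with h2 | h2 <;> rw [h1, h2] at e'
      · exact absurd e' hvw.ne
      · rw [e', h.invol]
      · exact e'.symm
      · exact absurd (σ.injective e') hvw.ne
    have h3 := h.adj v (by rw [← this]; exact hvw.ne')
    rw [← this, compl_adj] at h3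
    exact h3.2 hvw)
  exact C.colorable.mono (by simpa using hcard)

end SimpleGraph

/-! ### Links between matching edges and linkages -/

namespace SimpleGraph

open Finset Equiv

variable {V : Type*} {H : SimpleGraph V} {σ : Perm V}

/-- The matching edges `x (σ x)` and `y (σ y)` induce a subgraph of `H` in which at most the edge
`(σ x) (σ y)` joins them. -/
def IsLink (H : SimpleGraph V) (σ : Perm V) (x y : V) : Prop :=
  ¬ H.Adj x y ∧ ¬ H.Adj x (σ y) ∧ ¬ H.Adj (σ x) y

theorem IsLink.symm {x y : V} (h : IsLink H σ x y) : IsLink H σ y x :=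
  ⟨fun e => h.1 e.symm, fun e => h.2.2 e.symm, fun e => h.2.1 e.symm⟩

/-- The matching edges `x (σ x)` and `y (σ y)` are opposite edges of a four-cycle of `H`. -/
def IsSquare (H : SimpleGraph V) (σ : Perm V) (x y : V) : Prop :=
  (H.Adj x y ∧ H.Adj (σ x) (σ y)) ∨ (H.Adj x (σ y) ∧ H.Adj (σ x) y)

/-- Two matching edges in a triangle-free graph are linked or span a four-cycle. -/
theorem exists_link_of_not_square (htri : ∀ a b c, H.Adj a b → H.Adj b c → ¬ H.Adj a c)
    (h : IsPairing H σ) {v w : V} (hv : σ v ≠ v) (hw : σ w ≠ w) (hb : ¬ IsSquare H σ v w) :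
    ∃ v' w', (v' = v ∨ v' = σ v) ∧ (w' = w ∨ w' = σ w) ∧ IsLink H σ v' w' := by
  have hv' := h.adj v hv
  have hw' := h.adj w hw
  have iv := h.invol v
  have iw := h.invol w
  unfold IsSquare at hb
  push Not at hb
  by_cases h1 : H.Adj v w
  · refine ⟨σ v, σ w, Or.inr rfl, Or.inr rfl, hb.1 h1, ?_, ?_⟩
    · rw [iw]; exact fun e => htri _ _ _ hv'.symm h1 e
    · rw [iv]; exact fun e => htri _ _ _ h1 hw' e
  by_cases h2 : H.Adj v (σ w)
  · refine ⟨σ v, w, Or.inr rfl, Or.inl rfl, hb.2 h2, ?_, ?_⟩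
    · exact fun e => htri _ _ _ hv'.symm h2 e
    · rw [iv]; exact h1
  by_cases h3 : H.Adj (σ v) w
  · refine ⟨v, σ w, Or.inl rfl, Or.inr rfl, h2, ?_, ?_⟩
    · rw [iw]; exact h1
    · exact fun e => htri _ _ _ h3 hw' e
  exact ⟨v, w, Or.inl rfl, Or.inl rfl, h1, h2, h3⟩

/-- `v` lies on one of the two matching edges joined by the link `p`. -/
def OnLink (σ : Perm V) (p : V × V) (v : V) : Prop :=
  v = p.1 ∨ v = σ p.1 ∨ v = p.2 ∨ v = σ p.2

theorem OnLink.apply (h : IsPairing H σ) {p : V × V} {v : V} (hv : OnLink σ p v) :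
    OnLink σ p (σ v) := by
  rcases hv with rfl | rfl | rfl | rfl <;> simp [OnLink, h.invol]

variable [DecidableEq V] {T : Finset (V × V)}

/-- The vertices that occur in the pairs of `T`. -/
def linkEnds (T : Finset (V × V)) : Finset V := T.image Prod.fst ∪ T.image Prod.snd

theorem fst_mem_linkEnds {p : V × V} (h : p ∈ T) : p.1 ∈ linkEnds T :=
  mem_union_left _ (mem_image_of_mem _ h)

theorem snd_mem_linkEnds {p : V × V} (h : p ∈ T) : p.2 ∈ linkEnds T :=
  mem_union_right _ (mem_image_of_mem _ h)

theorem mem_linkEnds {v : V} : v ∈ linkEnds T ↔ ∃ p ∈ T, v = p.1 ∨ v = p.2 := by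
  simp only [linkEnds, mem_union, mem_image]
  constructor
  · rintro (⟨p, hp, rfl⟩ | ⟨p, hp, rfl⟩)
    · exact ⟨p, hp, Or.inl rfl⟩
    · exact ⟨p, hp, Or.inr rfl⟩
  · rintro ⟨p, hp, rfl | rfl⟩
    · exact Or.inl ⟨p, hp, rfl⟩
    · exact Or.inr ⟨p, hp, rfl⟩

theorem linkEnds_mono {T' : Finset (V × V)} (h : T' ⊆ T) : linkEnds T' ⊆ linkEnds T :=
  union_subset_union (image_subset_image h) (image_subset_image h)

theorem card_linkEnds_le (T : Finset (V × V)) : (linkEnds T).card ≤ 2 * T.card := by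
  refine (card_union_le _ _).trans ?_
  have h1 := card_image_le (s := T) (f := Prod.fst)
  have h2 := card_image_le (s := T) (f := Prod.snd)
  omega

theorem linkEnds_union (T T' : Finset (V × V)) :
    linkEnds (T ∪ T') = linkEnds T ∪ linkEnds T' := by
  ext v; simp only [mem_union, mem_linkEnds]; grind

theorem linkEnds_insert (p : V × V) (T : Finset (V × V)) :
    linkEnds (insert p T) = insert p.1 (insert p.2 (linkEnds T)) := by
  ext v; simp only [mem_insert, mem_linkEnds]; grind

/-- A matching together with links between pairwise disjoint pairs of its edges. -/
structure IsLinkage (H : SimpleGraph V) (σ : Perm V) (T : Finset (V × V)) : Prop where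
  pairing : IsPairing H σ
  link : ∀ p ∈ T, IsLink H σ p.1 p.2
  card : 2 * T.card ≤ (linkEnds T).card
  notMem : ∀ v ∈ linkEnds T, σ v ∉ linkEnds T

/-- The vertex `v` lies on a matching edge that no link uses. -/
def IsFree (σ : Perm V) (T : Finset (V × V)) (v : V) : Prop :=
  σ v ≠ v ∧ v ∉ linkEnds T ∧ σ v ∉ linkEnds T

theorem IsFree.apply (h : IsPairing H σ) {v : V} (hv : IsFree σ T v) : IsFree σ T (σ v) :=
  ⟨fun e => hv.1 (σ.injective e), hv.2.2, by rw [h.invol]; exact hv.2.1⟩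

theorem IsFree.mono {T' : Finset (V × V)} (h : T' ⊆ T) {v : V} (hv : IsFree σ T v) :
    IsFree σ T' v :=
  ⟨hv.1, fun e => hv.2.1 (linkEnds_mono h e), fun e => hv.2.2 (linkEnds_mono h e)⟩

theorem IsLinkage.mono (h : IsLinkage H σ T) {T' : Finset (V × V)} (hT : T' ⊆ T) :
    IsLinkage H σ T' := by
  refine ⟨h.pairing, fun p hp => h.link p (hT hp), ?_, fun v hv e =>
    h.notMem v (linkEnds_mono hT hv) (linkEnds_mono hT e)⟩
  have h1 : T = T' ∪ (T \ T') := (union_sdiff_of_subset hT).symm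
  have h2 := linkEnds_union T' (T \ T')
  rw [← h1] at h2
  have h3 := card_union_le (linkEnds T') (linkEnds (T \ T'))
  rw [← h2] at h3
  have h4 := card_linkEnds_le (T \ T')
  have h5 := card_sdiff_add_card_eq_card hT
  have h6 := h.card
  omega

theorem IsLinkage.insert_link (h : IsLinkage H σ T) {v w : V} (hv : IsFree σ T v)
    (hw : IsFree σ T w) (hwv : w ≠ v) (hwv' : w ≠ σ v) (hl : IsLink H σ v w) :
    IsLinkage H σ (insert (v, w) T) ∧ (insert (v, w) T).card = T.card + 1 := by
  have hT : (v, w) ∉ T := fun e => hv.2.1 (fst_mem_linkEnds e)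
  have hwv'' : v ≠ σ w := fun e => hwv' (by rw [e, h.pairing.invol])
  refine ⟨⟨h.pairing, ?_, ?_, ?_⟩, card_insert_of_notMem hT⟩
  · intro p hp
    rcases mem_insert.1 hp with rfl | hp
    · exact hl
    · exact h.link p hp
  · have h1 : v ∉ insert w (linkEnds T) := by simp [hwv.symm, hv.2.1]
    rw [linkEnds_insert, card_insert_of_notMem h1, card_insert_of_notMem hw.2.1,
      card_insert_of_notMem hT]
    have := h.card; omega
  · intro u hu
    rw [linkEnds_insert] at hu ⊢
    simp only [mem_insert, not_or] at hu ⊢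
    rcases hu with rfl | rfl | hu
    · exact ⟨hv.1, hwv'.symm, hv.2.2⟩
    · exact ⟨hwv''.symm, hw.1, hw.2.2⟩
    · refine ⟨fun e => hv.2.2 ?_, fun e => hw.2.2 ?_, h.notMem u hu⟩ <;>
      rw [← e, h.pairing.invol] <;> exact hu

/-- The field `card` forces equality in `card_linkEnds_le`, so no vertex occurs twice among the ends
of the links. -/
theorem IsLinkage.erase_ends (h : IsLinkage H σ T) {p : V × V} (hp : p ∈ T) :
    p.1 ∉ linkEnds (T.erase p) ∧ p.2 ∉ linkEnds (T.erase p) ∧ p.1 ≠ p.2 := by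
  have h1 := linkEnds_insert p (T.erase p)
  rw [insert_erase hp] at h1
  have h2 := card_linkEnds_le (T.erase p)
  have h3 := card_erase_add_one hp
  have h4 := h.card
  rw [h1] at h4
  have h5 := card_insert_le p.2 (linkEnds (T.erase p))
  refine ⟨fun e => ?_, fun e => ?_, fun e => ?_⟩
  · rw [insert_eq_of_mem (mem_insert_of_mem e)] at h4
    omega
  · rw [insert_eq_of_mem e] at h4
    have h6 := card_insert_le p.1 (linkEnds (T.erase p))
    omega
  · rw [e, insert_eq_of_mem (mem_insert_self _ _)] at h4
    omega

theorem IsLinkage.apply_ne (h : IsLinkage H σ T) {v : V} (hv : v ∈ linkEnds T) : σ v ≠ v :=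
  fun e => h.notMem v hv (by rw [e]; exact hv)

theorem IsLinkage.eq_of_end (h : IsLinkage H σ T) {p q : V × V} (hp : p ∈ T) (hq : q ∈ T) {v : V}
    (hvp : v = p.1 ∨ v = p.2) (hvq : v = q.1 ∨ v = q.2) : p = q := by
  by_contra hpq
  have hv : v ∈ linkEnds (T.erase p) := mem_linkEnds.2 ⟨q, mem_erase.2 ⟨Ne.symm hpq, hq⟩, hvq⟩
  obtain ⟨h1, h2, -⟩ := h.erase_ends hp
  rcases hvp with rfl | rfl
  · exact h1 hv
  · exact h2 hv

theorem IsLinkage.free_or (h : IsLinkage H σ T) {v : V} (hv : σ v ≠ v) :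
    IsFree σ T v ∨ ∃ p ∈ T, OnLink σ p v := by
  by_cases h1 : v ∈ linkEnds T
  · obtain ⟨p, hp, h2⟩ := mem_linkEnds.1 h1
    refine Or.inr ⟨p, hp, ?_⟩
    unfold OnLink; tauto
  by_cases h2 : σ v ∈ linkEnds T
  · obtain ⟨p, hp, h3⟩ := mem_linkEnds.1 h2
    refine Or.inr ⟨p, hp, ?_⟩
    rw [h.pairing.eq_iff, h.pairing.eq_iff] at h3
    unfold OnLink; tauto
  exact Or.inl ⟨hv, h1, h2⟩

theorem IsLinkage.onLink_ne (h : IsLinkage H σ T) {p : V × V} (hp : p ∈ T) {v : V}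
    (hv : OnLink σ p v) : σ v ≠ v := by
  have h1 := h.apply_ne (fst_mem_linkEnds hp)
  have h2 := h.apply_ne (snd_mem_linkEnds hp)
  rcases hv with rfl | rfl | rfl | rfl
  · exact h1
  · exact fun e => h1 (σ.injective e)
  · exact h2
  · exact fun e => h2 (σ.injective e)

theorem IsLinkage.not_free_of_onLink (h : IsLinkage H σ T) {p : V × V} (hp : p ∈ T) {v : V}
    (hv : OnLink σ p v) : ¬ IsFree σ T v := by
  rintro ⟨-, h1, h2⟩
  rcases hv with rfl | rfl | rfl | rfl
  · exact h1 (fst_mem_linkEnds hp)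
  · rw [h.pairing.invol] at h2; exact h2 (fst_mem_linkEnds hp)
  · exact h1 (snd_mem_linkEnds hp)
  · rw [h.pairing.invol] at h2; exact h2 (snd_mem_linkEnds hp)

theorem IsLinkage.free_erase (h : IsLinkage H σ T) {p : V × V} (hp : p ∈ T) {v : V}
    (hv : OnLink σ p v) : IsFree σ (T.erase p) v := by
  obtain ⟨h1, h2, -⟩ := h.erase_ends hp
  have key : ∀ v, v ∈ linkEnds T → v ∉ linkEnds (T.erase p) →
      IsFree σ (T.erase p) v := fun v h3 h4 =>
    ⟨h.apply_ne h3, h4, fun e => h.notMem v h3 (linkEnds_mono (erase_subset _ _) e)⟩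
  rcases hv with rfl | rfl | rfl | rfl
  · exact key _ (fst_mem_linkEnds hp) h1
  · exact (key _ (fst_mem_linkEnds hp) h1).apply h.pairing
  · exact key _ (snd_mem_linkEnds hp) h2
  · exact (key _ (snd_mem_linkEnds hp) h2).apply h.pairing

theorem IsLinkage.onLink_unique (h : IsLinkage H σ T) {p q : V × V} (hp : p ∈ T) (hq : q ∈ T)
    {v : V} (hvp : OnLink σ p v) (hvq : OnLink σ q v) : p = q := by
  by_contra hpq
  exact (h.mono (erase_subset p T)).not_free_of_onLink (mem_erase.2 ⟨Ne.symm hpq, hq⟩) hvq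
    (h.free_erase hp hvp)

/-- Replacing a link. -/
theorem IsLinkage.replace (h : IsLinkage H σ T) {p : V × V} (hp : p ∈ T) {v w : V}
    (hv : IsFree σ (T.erase p) v) (hw : IsFree σ (T.erase p) w)
    (hwv : w ≠ v) (hwv' : w ≠ σ v) (hl : IsLink H σ v w) :
    IsLinkage H σ (insert (v, w) (T.erase p)) ∧
      (insert (v, w) (T.erase p)).card = T.card := by
  obtain ⟨h1, h2⟩ := (h.mono (erase_subset p T)).insert_link hv hw hwv hwv' hl
  exact ⟨h1, by rw [h2, card_erase_add_one hp]⟩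

/-- Otherwise the two free edges could be linked, against maximality. -/
theorem IsLinkage.isSquare_of_free (h : IsLinkage H σ T)
    (htri : ∀ a b c, H.Adj a b → H.Adj b c → ¬ H.Adj a c)
    (hmax : ∀ T', IsLinkage H σ T' → T'.card ≤ T.card) {v w : V} (hv : IsFree σ T v)
    (hw : IsFree σ T w) (hwv : w ≠ v) (hwv' : w ≠ σ v) : IsSquare H σ v w := by
  by_contra hb
  obtain ⟨v', w', hv', hw', hl⟩ := exists_link_of_not_square htri h.pairing hv.1 hw.1 hb
  have iv := h.pairing.invol v
  have hvw2 : σ w ≠ v := fun e => hwv' (by rw [← e, h.pairing.invol])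
  have h1 : IsFree σ T v' := by
    rcases hv' with rfl | rfl
    exacts [hv, hv.apply h.pairing]
  have h2 : IsFree σ T w' := by
    rcases hw' with rfl | rfl
    exacts [hw, hw.apply h.pairing]
  have h3 : w' ≠ v' ∧ w' ≠ σ v' := by
    rcases hv' with rfl | rfl <;> rcases hw' with rfl | rfl
    · exact ⟨hwv, hwv'⟩
    · exact ⟨hvw2, fun e => hwv (σ.injective e)⟩
    · rw [iv]; exact ⟨hwv', hwv⟩
    · rw [iv]; exact ⟨fun e => hwv (σ.injective e), hvw2⟩
  obtain ⟨h4, h5⟩ := h.insert_link h1 h2 h3.1 h3.2 hl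
  have := hmax _ h4
  omega

/-- If both fail, the link `p` can be traded for two links: one from the edge of `p.1` to that of
`v`, and one from the edge of `p.2` to that of `w`. -/
theorem IsLinkage.isSquare_or (h : IsLinkage H σ T)
    (htri : ∀ a b c, H.Adj a b → H.Adj b c → ¬ H.Adj a c)
    (hmax : ∀ T', IsLinkage H σ T' → T'.card ≤ T.card) {p : V × V} (hp : p ∈ T)
    {v w : V} (hv : IsFree σ T v)
    (hw : IsFree σ T w) (hwv : w ≠ v) (hwv' : w ≠ σ v) :
    IsSquare H σ p.1 v ∨ IsSquare H σ p.2 w := by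
  by_contra hb
  push Not at hb
  have n1 := h.apply_ne (fst_mem_linkEnds hp)
  have n2 := h.apply_ne (snd_mem_linkEnds hp)
  have hvw2 : σ w ≠ v := fun e => hwv' (by rw [← e, h.pairing.invol])
  have hP := h.pairing
  obtain ⟨a, a', ha, ha', hl⟩ := exists_link_of_not_square htri h.pairing n1 hv.1 hb.1
  obtain ⟨b, b', hb, hb', hl'⟩ := exists_link_of_not_square htri h.pairing n2 hw.1 hb.2
  have on_a : OnLink σ p a := by unfold OnLink; tauto
  have on_b : OnLink σ p b := by unfold OnLink; tauto
  have fa : IsFree σ T a' := by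
    rcases ha' with rfl | rfl
    exacts [hv, hv.apply h.pairing]
  have fb : IsFree σ T b' := by
    rcases hb' with rfl | rfl
    exacts [hw, hw.apply h.pairing]
  have h1 : ∀ x y, OnLink σ p x → IsFree σ T y → y ≠ x ∧ y ≠ σ x := fun x y hx hy =>
    ⟨fun e => h.not_free_of_onLink hp hx (e ▸ hy),
      fun e => h.not_free_of_onLink hp (hx.apply hP) (e ▸ hy)⟩
  have h2 : ∀ x y, (x = v ∨ x = σ v) → (y = w ∨ y = σ w) → y ≠ x ∧ y ≠ σ x := by
    have iv := hP.invol v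
    rintro x y (rfl | rfl) (rfl | rfl)
    · exact ⟨hwv, hwv'⟩
    · exact ⟨hvw2, fun e => hwv (σ.injective e)⟩
    · rw [iv]; exact ⟨hwv', hwv⟩
    · rw [iv]; exact ⟨fun e => hwv (σ.injective e), hvw2⟩
  have h3 : b ≠ a ∧ b ≠ σ a := by
    have i1 := hP.invol p.1
    have hne := (h.erase_ends hp).2.2.symm
    have hne' : p.2 ≠ σ p.1 := fun e =>
      h.notMem _ (fst_mem_linkEnds hp) (e ▸ snd_mem_linkEnds hp)
    have hne'' : σ p.2 ≠ p.1 := fun e =>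
      h.notMem _ (snd_mem_linkEnds hp) (e ▸ fst_mem_linkEnds hp)
    rcases ha with rfl | rfl <;> rcases hb with rfl | rfl
    · exact ⟨hne, hne'⟩
    · exact ⟨hne'', fun e => hne (σ.injective e)⟩
    · rw [i1]; exact ⟨hne', hne⟩
    · rw [i1]; exact ⟨fun e => hne (σ.injective e), hne''⟩
  obtain ⟨g1, c1⟩ := h.replace hp (h.free_erase hp on_a) (fa.mono (erase_subset _ _))
    (h1 _ _ on_a fa).1 (h1 _ _ on_a fa).2 hl
  have key : ∀ y, IsFree σ (T.erase p) y → y ≠ a → y ≠ σ a → y ≠ a' → y ≠ σ a' →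
      IsFree σ (insert (a, a') (T.erase p)) y := by
    intro y hy e1 e2 e3 e4
    refine ⟨hy.1, ?_, ?_⟩ <;> rw [linkEnds_insert] <;> simp only [mem_insert, not_or]
    · exact ⟨e1, e3, hy.2.1⟩
    · exact ⟨fun e => e2 (hP.eq_iff.1 e), fun e => e4 (hP.eq_iff.1 e), hy.2.2⟩
  have fb1 : IsFree σ (insert (a, a') (T.erase p)) b := by
    have h4 := h1 _ _ on_b fa
    exact key _ (h.free_erase hp on_b) h3.1 h3.2 h4.1.symm fun e => h4.2 (hP.eq_iff.1 e.symm)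
  have fb2 : IsFree σ (insert (a, a') (T.erase p)) b' := by
    have h4 := h1 _ _ on_a fb
    have h5 := h2 _ _ ha' hb'
    exact key _ (fb.mono (erase_subset _ _)) h4.1 h4.2 h5.1 h5.2
  obtain ⟨g2, c2⟩ := g1.insert_link fb1 fb2 (h1 _ _ on_b fb).1 (h1 _ _ on_b fb).2 hl'
  have := hmax _ g2
  omega

end SimpleGraph

/-! ### The complete bipartite graph on the free vertices and its extension -/

namespace SimpleGraph

open Finset Equiv

variable {V : Type*} [DecidableEq V] {H : SimpleGraph V} {σ : Perm V} {T : Finset (V × V)}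
  {A : Finset V}

/-- `A` is one side of the complete bipartite graph that the free vertices induce in `H`. -/
structure IsFreeSide (H : SimpleGraph V) (σ : Perm V) (T : Finset (V × V)) (A : Finset V) :
    Prop where
  free : ∀ v ∈ A, IsFree σ T v
  cover : ∀ v, IsFree σ T v → v ∈ A ∨ σ v ∈ A
  notMem : ∀ v ∈ A, σ v ∉ A
  adj : ∀ v ∈ A, ∀ w ∈ A, H.Adj v (σ w)

theorem IsLinkage.exists_isFreeSide [Fintype V] (h : IsLinkage H σ T)
    (htri : ∀ a b c, H.Adj a b → H.Adj b c → ¬ H.Adj a c)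
    (hmax : ∀ T', IsLinkage H σ T' → T'.card ≤ T.card) : ∃ A, IsFreeSide H σ T A := by
  classical
  by_cases hex : ∃ j, IsFree σ T j
  · obtain ⟨j, hj⟩ := hex
    have hP := h.pairing
    have hmem : ∀ v, v ∈ (univ.filter fun v => IsFree σ T v ∧ H.Adj (σ j) v) ↔
        IsFree σ T v ∧ H.Adj (σ j) v := fun v => by simp
    -- The side of a fixed free vertex `j` consists of the free neighbours of its partner.
    -- Four-cycles determine all further adjacencies, since triangles are excluded.
    refine ⟨univ.filter fun v => IsFree σ T v ∧ H.Adj (σ j) v, ⟨?_, ?_, ?_, ?_⟩⟩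
    · exact fun v hv => ((hmem v).1 hv).1
    · intro v hv
      rw [hmem, hmem]
      by_cases h1 : v = j
      · subst h1; exact Or.inl ⟨hv, (hP.adj v hv.1).symm⟩
      by_cases h2 : v = σ j
      · subst h2
        rw [hP.invol]
        exact Or.inr ⟨hj, (hP.adj j hj.1).symm⟩
      rcases h.isSquare_of_free htri hmax hj hv h1 h2 with h3 | h3
      · exact Or.inr ⟨hv.apply hP, h3.2⟩
      · exact Or.inl ⟨hv, h3.2⟩
    · intro v hv hv'
      rw [hmem] at hv hv'
      exact htri _ _ _ hv.2 (hP.adj v hv.1.1) hv'.2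
    · intro v hv w hw
      rw [hmem] at hv hw
      by_cases h1 : w = v
      · subst h1; exact hP.adj w hw.1.1
      by_cases h2 : w = σ v
      · subst h2
        exact absurd hw.2 (htri _ _ _ hv.2 (hP.adj v hv.1.1))
      rcases h.isSquare_of_free htri hmax hv.1 hw.1 h1 h2 with h3 | h3
      · exact absurd hw.2 (htri _ _ _ hv.2 h3.1)
      · exact h3.1
  · push Not at hex
    exact ⟨∅, by simp, fun v hv => absurd hv (hex v), by simp, by simp⟩

theorem IsLinkage.card_le [Fintype V] (h : IsLinkage H σ T)
    (hA : ∀ v, IsFree σ T v → v ∈ A ∨ σ v ∈ A) :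
    Fintype.card V ≤ (unmatched σ).card + 4 * T.card + 2 * A.card := by
  have hsub : (univ : Finset V) ⊆ unmatched σ ∪ (linkEnds T ∪ (linkEnds T).map σ.toEmbedding) ∪
      (A ∪ A.map σ.toEmbedding) := by
    intro v _
    have hs : σ.symm v = σ v := by rw [symm_apply_eq, h.pairing.invol]
    simp only [mem_union, mem_map_equiv, hs, mem_unmatched]
    by_cases h1 : σ v = v
    · tauto
    by_cases h2 : v ∈ linkEnds T
    · tauto
    by_cases h3 : σ v ∈ linkEnds T
    · tauto
    have := hA v ⟨h1, h2, h3⟩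
    tauto
  have h1 := card_le_card hsub
  rw [card_univ] at h1
  have h2 := card_union_le (unmatched σ ∪ (linkEnds T ∪ (linkEnds T).map σ.toEmbedding))
    (A ∪ A.map σ.toEmbedding)
  have h3 := card_union_le (unmatched σ) (linkEnds T ∪ (linkEnds T).map σ.toEmbedding)
  have h4 := card_union_le (linkEnds T) ((linkEnds T).map σ.toEmbedding)
  have h5 := card_union_le A (A.map σ.toEmbedding)
  have h6 := card_linkEnds_le T
  rw [card_map] at h4 h5
  omega

open Classical in
/-- The vertices `v` such that `v` and `σ v` are joined to the two sides of the complete bipartite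
graph on `A ∪ σ A` like a vertex of `A` and its partner, up to one matching edge. -/
noncomputable def extendedSide [Fintype V] (H : SimpleGraph V) (σ : Perm V) (A : Finset V) :
    Finset V :=
  univ.filter fun v => ∃ j ∈ A, ∀ j' ∈ A, j' ≠ j → H.Adj v (σ j') ∧ H.Adj (σ v) j'

theorem mem_extendedSide [Fintype V] {v : V} : v ∈ extendedSide H σ A ↔
    ∃ j ∈ A, ∀ j' ∈ A, j' ≠ j → H.Adj v (σ j') ∧ H.Adj (σ v) j' := by
  simp [extendedSide]

theorem exists_mem_ne_ne (hA : 3 ≤ A.card) (a b : V) : ∃ j ∈ A, j ≠ a ∧ j ≠ b := by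
  have h1 : 0 < ((A.erase a).erase b).card := by
    have h2 := pred_card_le_card_erase (s := A) (a := a)
    have h3 := pred_card_le_card_erase (s := A.erase a) (a := b)
    omega
  obtain ⟨j, hj⟩ := card_pos.1 h1
  simp only [mem_erase] at hj
  exact ⟨j, hj.2.2, hj.2.1, hj.1⟩

theorem isFree_replace_iff (h : IsLinkage H σ T) {p q : V × V} (hp : p ∈ T)
    (hq : ∀ v, OnLink σ q v ↔ OnLink σ p v) (v : V) :
    IsFree σ (insert q (T.erase p)) v ↔ IsFree σ T v := by
  have key : ∀ (r : V × V) (S : Finset (V × V)),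
      IsFree σ (insert r S) v ↔ IsFree σ S v ∧ ¬ OnLink σ r v := by
    intro r S
    have h1 : v = σ r.1 ↔ σ v = r.1 := h.pairing.eq_iff.symm
    have h2 : v = σ r.2 ↔ σ v = r.2 := h.pairing.eq_iff.symm
    simp only [IsFree, OnLink, linkEnds_insert, mem_insert, h1, h2]
    tauto
  rw [key, hq, ← key, insert_erase hp]

section Side

variable [Fintype V]

/-- Each of `v` and `w` has one exceptional element of `A`; a third element serves both. This is
where three free edges are needed. -/
theorem exists_common (hA3 : 3 ≤ A.card) {v w : V} (hv : v ∈ extendedSide H σ A)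
    (hw : w ∈ extendedSide H σ A) :
    ∃ j ∈ A, H.Adj v (σ j) ∧ H.Adj (σ v) j ∧ H.Adj w (σ j) ∧ H.Adj (σ w) j := by
  obtain ⟨a, -, ha⟩ := mem_extendedSide.1 hv
  obtain ⟨b, -, hb⟩ := mem_extendedSide.1 hw
  obtain ⟨j, hj, h1, h2⟩ := exists_mem_ne_ne hA3 a b
  exact ⟨j, hj, (ha j hj h1).1, (ha j hj h1).2, (hb j hj h2).1, (hb j hj h2).2⟩

theorem extendedSide_not_adj (htri : ∀ a b c, H.Adj a b → H.Adj b c → ¬ H.Adj a c)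
    (hA3 : 3 ≤ A.card) {v w : V} (hv : v ∈ extendedSide H σ A) (hw : w ∈ extendedSide H σ A) :
    ¬ H.Adj v w ∧ ¬ H.Adj (σ v) (σ w) := by
  obtain ⟨j, -, h1, h2, h3, h4⟩ := exists_common hA3 hv hw
  exact ⟨htri _ _ _ h1 h3.symm, htri _ _ _ h2 h4.symm⟩

theorem extendedSide_notMem (hP : IsPairing H σ)
    (htri : ∀ a b c, H.Adj a b → H.Adj b c → ¬ H.Adj a c) (hA : IsFreeSide H σ T A)
    (hA3 : 3 ≤ A.card) {v : V} (hv : v ∈ extendedSide H σ A) : σ v ∉ extendedSide H σ A := by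
  intro hw
  obtain ⟨j, hj, h1, h2, h3, h4⟩ := exists_common hA3 hv hw
  rw [hP.invol] at h4
  exact htri _ _ _ h4 (hA.adj j hj j hj) h1

theorem extendedSide_apply_ne (htri : ∀ a b c, H.Adj a b → H.Adj b c → ¬ H.Adj a c)
    (hA : IsFreeSide H σ T A) (hA3 : 3 ≤ A.card) {v : V} (hv : v ∈ extendedSide H σ A) :
    σ v ≠ v := by
  intro e
  obtain ⟨j, hj, h1, h2, -⟩ := exists_common hA3 hv hv
  rw [e] at h2
  exact htri _ _ _ h2 (hA.adj j hj j hj) h1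

theorem IsFreeSide.subset_extendedSide (hA : IsFreeSide H σ T A) : A ⊆ extendedSide H σ A :=
  fun v hv => mem_extendedSide.2 ⟨v, hv, fun j hj _ =>
    ⟨hA.adj v hv j hj, (hA.adj j hj v hv).symm⟩⟩

/-- A four-cycle on two matching edges has two possible orientations. Different orientations for `i`
and `j'` would join `v` or `σ v` to two adjacent vertices of the complete bipartite graph, which is
a triangle. -/
theorem mem_extendedSide_or (hP : IsPairing H σ)
    (htri : ∀ a b c, H.Adj a b → H.Adj b c → ¬ H.Adj a c) (hA : IsFreeSide H σ T A)
    (hA3 : 3 ≤ A.card) {v j : V} (hj : j ∈ A)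
    (hb : ∀ j' ∈ A, j' ≠ j → IsSquare H σ v j') :
    v ∈ extendedSide H σ A ∨ σ v ∈ extendedSide H σ A := by
  obtain ⟨i, hi, hij, -⟩ := exists_mem_ne_ne hA3 j j
  rw [mem_extendedSide, mem_extendedSide, hP.invol]
  rcases hb i hi hij with h1 | h1
  · refine Or.inr ⟨j, hj, fun j' hj' hne => ?_⟩
    rcases hb j' hj' hne with h2 | h2
    · exact ⟨h2.2, h2.1⟩
    · exact absurd h2.1 (htri _ _ _ h1.1 (hA.adj i hi j' hj'))
  · refine Or.inl ⟨j, hj, fun j' hj' hne => ?_⟩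
    rcases hb j' hj' hne with h2 | h2
    · exact absurd h1.1 (htri _ _ _ h2.1 (hA.adj j' hj' i hi))
    · exact h2

theorem exists_two_not_isSquare (hP : IsPairing H σ)
    (htri : ∀ a b c, H.Adj a b → H.Adj b c → ¬ H.Adj a c) (hA : IsFreeSide H σ T A)
    (hA3 : 3 ≤ A.card) {v : V}
    (hv : ¬ (v ∈ extendedSide H σ A ∨ σ v ∈ extendedSide H σ A)) :
    ∃ i ∈ A, ∃ j ∈ A, i ≠ j ∧ ¬ IsSquare H σ v i ∧ ¬ IsSquare H σ v j := by
  have key : ∀ i ∈ A, ∃ j ∈ A, j ≠ i ∧ ¬ IsSquare H σ v j := by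
    intro i hi
    by_contra hc
    push Not at hc
    exact hv (mem_extendedSide_or hP htri hA hA3 hi hc)
  obtain ⟨i, hi⟩ := card_pos.1 (lt_of_lt_of_le (by norm_num) hA3)
  obtain ⟨j, hj, -, hj'⟩ := key i hi
  obtain ⟨l, hl, hlj, hl'⟩ := key j hj
  exact ⟨l, hl, j, hj, hlj, hl', hj'⟩

/-- The edge of `p.2` fails to span a four-cycle with two free edges, and one of these differs from
that of `j`; now `IsLinkage.isSquare_or` leaves no other choice. Consequently at most one edge of a
link lies outside the extended sides. -/
theorem IsLinkage.isSquare_fst (h : IsLinkage H σ T)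
    (htri : ∀ a b c, H.Adj a b → H.Adj b c → ¬ H.Adj a c)
    (hmax : ∀ T', IsLinkage H σ T' → T'.card ≤ T.card) (hA : IsFreeSide H σ T A)
    (hA3 : 3 ≤ A.card) {p : V × V} (hp : p ∈ T)
    (hv : ¬ (p.2 ∈ extendedSide H σ A ∨ σ p.2 ∈ extendedSide H σ A)) {j : V} (hj : j ∈ A) :
    IsSquare H σ p.1 j := by
  obtain ⟨a, ha, b, hb, hab, h1, h2⟩ := exists_two_not_isSquare h.pairing htri hA hA3 hv
  have key : ∀ i ∈ A, i ≠ j → ¬ IsSquare H σ p.2 i → IsSquare H σ p.1 j := fun i hi hji hs =>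
    (h.isSquare_or htri hmax hp (hA.free j hj) (hA.free i hi) hji
      fun e => hA.notMem j hj (e ▸ hi)).resolve_right hs
  by_cases hja : a = j
  · exact key b hb (fun e => hab (hja.trans e.symm)) h2
  · exact key a ha hja h1

/-- The links can be reoriented so that those with all ends in the extended sides lead from the
extended side of `A` to the other one. -/
theorem IsLinkage.exists_oriented (h : IsLinkage H σ T)
    (htri : ∀ a b c, H.Adj a b → H.Adj b c → ¬ H.Adj a c)
    (hA : IsFreeSide H σ T A) (hA3 : 3 ≤ A.card) :
    ∃ T', IsLinkage H σ T' ∧ T'.card = T.card ∧ IsFreeSide H σ T' A ∧ ∀ p ∈ T',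
      (p.1 ∈ extendedSide H σ A ∨ σ p.1 ∈ extendedSide H σ A) →
      (p.2 ∈ extendedSide H σ A ∨ σ p.2 ∈ extendedSide H σ A) →
      p.1 ∈ extendedSide H σ A ∧ σ p.2 ∈ extendedSide H σ A := by
  classical
  set X := extendedSide H σ A with hX
  -- The number of well-oriented links is maximised over linkages of the same size and with the same
  -- free side.
  obtain ⟨T', hT', hmaxT⟩ := exists_max_image
    (univ.filter fun S : Finset (V × V) => IsLinkage H σ S ∧ S.card = T.card ∧
      IsFreeSide H σ S A)
    (fun S : Finset (V × V) => (S.filter fun p : V × V => p.1 ∈ X ∧ σ p.2 ∈ X).card) ⟨T, by simp [h, hA]⟩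
  simp only [mem_filter, mem_univ, true_and] at hT' hmaxT
  obtain ⟨g, hc, gA⟩ := hT'
  refine ⟨T', g, hc, gA, fun p hp h1 h2 => ?_⟩
  by_contra hnot
  have hP := h.pairing
  have i1 := hP.invol p.1
  have i2 := hP.invol p.2
  have hl := g.link p hp
  have hne := (g.erase_ends hp).2.2.symm
  have hne' : p.2 ≠ σ p.1 := fun e => g.notMem _ (fst_mem_linkEnds hp) (e ▸ snd_mem_linkEnds hp)
  have hne'' : σ p.2 ≠ p.1 := fun e => g.notMem _ (snd_mem_linkEnds hp) (e ▸ fst_mem_linkEnds hp)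
  have key : ∀ q : V × V, (q.1 ∈ X ∧ σ q.2 ∈ X) → IsLink H σ q.1 q.2 →
      (∀ v, OnLink σ q v ↔ OnLink σ p v) → q.2 ≠ q.1 → q.2 ≠ σ q.1 → False := by
    intro q hq hlq hon n1 n2
    obtain ⟨g1, c1⟩ := g.replace hp (g.free_erase hp ((hon _).1 (Or.inl rfl)))
      (g.free_erase hp ((hon q.2).1 (Or.inr (Or.inr (Or.inl rfl))))) n1 n2 hlq
    have hfree := isFree_replace_iff g hp hon
    have := hmaxT _ ⟨g1, c1.trans hc, ⟨fun v hv => (hfree v).2 (gA.free v hv),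
      fun v hv => gA.cover v ((hfree v).1 hv), gA.notMem, gA.adj⟩⟩
    have hqn : q ∉ T'.erase p := fun hq' =>
      (g.erase_ends hp).1 (by
        have h3 := (g.mono (erase_subset p T')).not_free_of_onLink hq' (v := q.1) (Or.inl rfl)
        exact absurd (g.free_erase hp ((hon _).1 (Or.inl rfl))) h3)
    rw [filter_insert, if_pos hq, filter_erase, erase_eq_of_notMem (by simp [hnot]),
      card_insert_of_notMem] at this
    · omega
    · intro hq'
      have h3 := (mem_filter.1 hq').1
      by_cases hqp : q = p
      · exact hnot (hqp ▸ hq)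
      · exact hqn (mem_erase.2 ⟨hqp, h3⟩)
  -- A wrongly oriented link is replaced by another pair of ends on the same two matching edges. It
  -- is a link because both extended sides are independent.
  rcases h1 with h1 | h1 <;> rcases h2 with h2 | h2
  · refine key (p.1, σ p.2) ⟨h1, by rwa [i2]⟩ ⟨hl.2.1, by rw [i2]; exact hl.1,
      (extendedSide_not_adj htri hA3 h1 h2).2⟩ (fun v => ?_) hne'' (fun e => hne (σ.injective e))
    simp only [OnLink, i2]; tauto
  · exact hnot ⟨h1, h2⟩
  · refine key (p.2, p.1) ⟨h2, h1⟩ hl.symm (fun v => ?_) hne.symm hne''.symm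
    simp only [OnLink]; tauto
  · refine key (σ p.1, p.2) ⟨h1, h2⟩ ⟨hl.2.2, (extendedSide_not_adj htri hA3 h1 h2).1,
      by rw [i1]; exact hl.1⟩ (fun v => ?_) hne' (by rw [i1]; exact hne)
    simp only [OnLink, i1]; tauto

/-- A covered vertex outside the extended sides lies on a link not counted among the side links, and
each such link has at most one matching edge outside; `g` selects it. -/
theorem IsLinkage.card_le_extendedSide (h : IsLinkage H σ T)
    (htri : ∀ a b c, H.Adj a b → H.Adj b c → ¬ H.Adj a c)
    (hmax : ∀ T', IsLinkage H σ T' → T'.card ≤ T.card) (hA : IsFreeSide H σ T A)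
    (hA3 : 3 ≤ A.card) :
    Fintype.card V ≤ (unmatched σ).card + 2 * (T.filter fun p =>
      ¬ (p.1 ∈ extendedSide H σ A ∧ σ p.2 ∈ extendedSide H σ A)).card +
      2 * (extendedSide H σ A).card := by
  classical
  set X := extendedSide H σ A with hX
  set T₁ := T.filter fun p => ¬ (p.1 ∈ X ∧ σ p.2 ∈ X) with hT₁
  have hP := h.pairing
  let g : V × V → V := fun p => if p.1 ∈ X ∨ σ p.1 ∈ X then p.2 else p.1
  have hsub : (univ : Finset V) ⊆ unmatched σ ∪ T₁.biUnion (fun p => {g p, σ (g p)}) ∪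
      (X ∪ X.map σ.toEmbedding) := by
    intro v _
    have hs : σ.symm v = σ v := by rw [symm_apply_eq, hP.invol]
    simp only [mem_union, mem_map_equiv, hs, mem_unmatched, mem_biUnion, mem_insert,
      mem_singleton]
    by_cases h1 : σ v = v
    · tauto
    by_cases h2 : v ∈ X ∨ σ v ∈ X
    · tauto
    refine Or.inl (Or.inr ?_)
    rcases h.free_or h1 with h3 | ⟨p, hp, h3⟩
    · exact absurd ((hA.cover v h3).imp (fun e => hA.subset_extendedSide e)
        fun e => hA.subset_extendedSide e) h2
    have hor' : ∀ w, (v = w ∨ v = σ w) → ¬ (w ∈ X ∨ σ w ∈ X) := by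
      rintro w (rfl | rfl)
      · exact h2
      · rw [hP.invol] at h2; tauto
    obtain ⟨j, hj⟩ := card_pos.1 (lt_of_lt_of_le (by norm_num) hA3)
    by_cases h4 : v = p.1 ∨ v = σ p.1
    · have h5 := hor' _ h4
      refine ⟨p, ?_, ?_⟩
      · rw [hT₁, mem_filter]; tauto
      · simp only [g, if_neg h5]; exact h4
    · have h4' : v = p.2 ∨ v = σ p.2 := by unfold OnLink at h3; tauto
      have h5 := hor' _ h4'
      refine ⟨p, ?_, ?_⟩
      · rw [hT₁, mem_filter]; tauto
      · have h6 : p.1 ∈ X ∨ σ p.1 ∈ X := mem_extendedSide_or hP htri hA hA3 hj fun j' hj' _ =>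
          h.isSquare_fst htri hmax hA hA3 hp h5 hj'
        simp only [g, if_pos h6]; exact h4'
  have h1 := card_le_card hsub
  rw [card_univ] at h1
  have h2 := card_union_le (unmatched σ ∪ T₁.biUnion (fun p => {g p, σ (g p)}))
    (X ∪ X.map σ.toEmbedding)
  have h3 := card_union_le (unmatched σ) (T₁.biUnion (fun p => {g p, σ (g p)}))
  have h4 : (T₁.biUnion (fun p => {g p, σ (g p)})).card ≤ T₁.card * 2 :=
    card_biUnion_le_card_mul _ _ _ fun p _ => card_le_two
  have h5 := card_union_le X (X.map σ.toEmbedding)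
  rw [card_map] at h5
  omega

end Side

end SimpleGraph

/-! ### Bipartite matchings: augmentation and the deficiency form of Hall's theorem -/

namespace SimpleGraph

open Finset Equiv

/-- A larger matching of a bipartite graph augments a smaller one: there is a matching that covers
the vertices covered by the smaller one and one more on either side. -/
theorem exists_augmented_matching {α β : Type*} [DecidableEq α] [DecidableEq β] (n : ℕ) :
    ∀ (F₀ F : Finset (α × β)), F.card = n → F₀.card < F.card →
      Set.InjOn Prod.fst (F₀ : Set (α × β)) → Set.InjOn Prod.snd (F₀ : Set (α × β)) →
      Set.InjOn Prod.fst (F : Set (α × β)) → Set.InjOn Prod.snd (F : Set (α × β)) →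
      ∃ F₁ ⊆ F₀ ∪ F, ∃ a b, F₁.card = F₀.card + 1 ∧ a ∉ F₀.image Prod.fst ∧
        b ∉ F₀.image Prod.snd ∧ F₁.image Prod.fst = insert a (F₀.image Prod.fst) ∧
        F₁.image Prod.snd = insert b (F₀.image Prod.snd) := by
  induction n with
  | zero => intro F₀ F h1 h2; omega
  | succ n ih =>
    intro F₀ F hn hlt i1 i2 j1 j2
    obtain ⟨q, hq, hq1⟩ : ∃ q ∈ F, q.1 ∉ F₀.image Prod.fst := by
      by_contra hc
      push Not at hc
      have h1 : F.image Prod.fst ⊆ F₀.image Prod.fst := by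
        intro a ha
        obtain ⟨q, hq, rfl⟩ := mem_image.1 ha
        exact hc q hq
      have h2 := card_le_card h1
      rw [card_image_of_injOn j1] at h2
      have h3 := card_image_le (s := F₀) (f := Prod.fst)
      omega
    by_cases hq2 : q.2 ∈ F₀.image Prod.snd
    · obtain ⟨r, hr, hrq⟩ := mem_image.1 hq2
      have e1 := card_erase_add_one hr
      have e2 := card_erase_add_one hq
      obtain ⟨F₁, hF₁, a, b, hc, ha, hb, hfst, hsnd⟩ := ih (F₀.erase r) (F.erase q) (by omega)
        (by omega) (i1.mono (erase_subset _ _)) (i2.mono (erase_subset _ _))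
        (j1.mono (erase_subset _ _)) (j2.mono (erase_subset _ _))
      have k1 : F₀.image Prod.fst = insert r.1 ((F₀.erase r).image Prod.fst) := by
        rw [← image_insert, insert_erase hr]
      have k2 : F₀.image Prod.snd = insert r.2 ((F₀.erase r).image Prod.snd) := by
        rw [← image_insert, insert_erase hr]
      -- The edges `q` of `F` and `r` of `F₀` share their second end. With both removed, the
      -- augmented matching avoids the ends of `q`, so `q` or `r` can be added back.
      have n1 : ∀ s ∈ F₁, s.1 ≠ q.1 ∧ s.2 ≠ q.2 := by
        intro s hs
        rcases mem_union.1 (hF₁ hs) with h | h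
        · obtain ⟨h1, h2⟩ := mem_erase.1 h
          exact ⟨fun e => hq1 (e ▸ mem_image_of_mem _ h2),
            fun e => h1 (i2 h2 hr (e.trans hrq.symm))⟩
        · obtain ⟨h1, h2⟩ := mem_erase.1 h
          exact ⟨fun e => h1 (j1 h2 hq e), fun e => h1 (j2 h2 hq e)⟩
      have haq : a ≠ q.1 := by
        obtain ⟨s, hs, rfl⟩ := mem_image.1 (hfst ▸ mem_insert_self a _ : a ∈ F₁.image Prod.fst)
        exact (n1 s hs).1
      have hbq : b ≠ q.2 := by
        obtain ⟨s, hs, rfl⟩ := mem_image.1 (hsnd ▸ mem_insert_self b _ : b ∈ F₁.image Prod.snd)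
        exact (n1 s hs).2
      have hsub : F₁ ⊆ F₀ ∪ F := hF₁.trans
        (union_subset_union (erase_subset _ _) (erase_subset _ _))
      have hb' : b ∉ F₀.image Prod.snd := by
        rw [k2, mem_insert, not_or, hrq]; exact ⟨hbq, hb⟩
      -- If the new first end is `r.1`, adding `q` restores `r.2` and makes `q.1` the new first end.
      -- Otherwise `r` itself fits.
      by_cases har : a = r.1
      · refine ⟨insert q F₁, insert_subset (mem_union_right _ hq) hsub, q.1, b, ?_, hq1, hb', ?_, ?_⟩
        · rw [card_insert_of_notMem fun h => (n1 q h).1 rfl, hc, e1]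
        · rw [image_insert, hfst, har, k1]
        · rw [image_insert, hsnd, k2, hrq, insert_comm]
      · have hrF : r.1 ∉ F₁.image Prod.fst := by
          rw [hfst, mem_insert, not_or]
          refine ⟨Ne.symm har, fun h => ?_⟩
          obtain ⟨s, hs, hsr⟩ := mem_image.1 h
          obtain ⟨h1, h2⟩ := mem_erase.1 hs
          exact h1 (i1 h2 hr hsr)
        refine ⟨insert r F₁, insert_subset (mem_union_left _ hr) hsub, a, b, ?_, ?_, hb', ?_, ?_⟩
        · rw [card_insert_of_notMem fun h => hrF (mem_image_of_mem _ h), hc, e1]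
        · rw [k1, mem_insert, not_or]; exact ⟨har, ha⟩
        · rw [image_insert, hfst, k1, insert_comm]
        · rw [image_insert, hsnd, k2, insert_comm]
    · refine ⟨insert q F₀, insert_subset (mem_union_right _ hq) subset_union_left, q.1, q.2, ?_,
        hq1, hq2, image_insert .., image_insert ..⟩
      exact card_insert_of_notMem fun h => hq1 (mem_image_of_mem _ h)

/-- The deficiency version of Hall's theorem, stated symmetrically: a bipartite graph without a
matching of size `p + 1` has large sets `X'`, `Y'` without edges between them. -/
theorem exists_matching_or_unrelated {V : Type*} [DecidableEq V] (r : V → V → Prop)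
    (X Y : Finset V) (p : ℕ) :
    (∃ F : Finset (V × V), F.card = p + 1 ∧ (∀ q ∈ F, q.1 ∈ X ∧ q.2 ∈ Y ∧ r q.1 q.2) ∧
      Set.InjOn Prod.fst (F : Set (V × V)) ∧ Set.InjOn Prod.snd (F : Set (V × V))) ∨
    ∃ X' ⊆ X, ∃ Y' ⊆ Y, (∀ x ∈ X', ∀ y ∈ Y', ¬ r x y) ∧ X.card ≤ X'.card + p ∧
      Y.card ≤ Y'.card + p := by
  classical
  by_cases hp : X.card ≤ p
  · exact Or.inr ⟨∅, by simp, Y, Subset.rfl, by simp, by omega, by omega⟩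
  -- With `d` dummy vertices joined to all of `X`, a matching that saturates `X` has at least `p +
  -- 1` genuine edges. A violator `s` of Hall's condition yields `X' = s`, and `Y'` is the set of
  -- non-neighbours of `s` in `Y`.
  let d := X.card - (p + 1)
  let t : X → Finset (V ⊕ Fin d) := fun x => (Y.filter fun y => r x y).disjSum univ
  by_cases hall : ∀ s : Finset X, s.card ≤ (s.biUnion t).card
  · left
    obtain ⟨f, hf, hft⟩ := (all_card_le_biUnion_card_iff_exists_injective t).1 hall
    have hg : ∀ x : X, (f x).isLeft → ∃ y, f x = Sum.inl y ∧ y ∈ Y ∧ r x y := by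
      intro x hx
      obtain ⟨y, hy⟩ := Sum.isLeft_iff.1 hx
      have := hft x
      rw [hy] at this
      simp only [t, inl_mem_disjSum, mem_filter] at this
      exact ⟨y, hy, this⟩
    have : Nonempty V := ⟨(card_pos.1 (by omega : 0 < X.card)).choose⟩
    choose! g hg1 hg2 hg3 using hg
    let S : Finset X := univ.filter fun x => (f x).isLeft
    have hS : p + 1 ≤ S.card := by
      have h1 : (univ \ S).card ≤ d := by
        have h2 : ((univ \ S).image f).card ≤ ((∅ : Finset V).disjSum (univ : Finset (Fin d))).card := by
          apply card_le_card
          intro z hz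
          obtain ⟨x, hx, rfl⟩ := mem_image.1 hz
          simp only [S, mem_sdiff, mem_univ, mem_filter, true_and, Bool.not_eq_true,
            Sum.isLeft_eq_false, Sum.isRight_iff] at hx
          obtain ⟨y, hy⟩ := hx
          rw [hy]; simp
        rwa [card_image_of_injective _ hf, card_disjSum, card_empty, card_univ, Fintype.card_fin,
          zero_add] at h2
      have h3 := card_sdiff_add_card_eq_card (subset_univ S)
      rw [card_univ, Fintype.card_coe] at h3
      omega
    obtain ⟨S', hS', hc⟩ := exists_subset_card_eq hS
    have hmem : ∀ x ∈ S', (f x).isLeft := fun x hx => (mem_filter.1 (hS' hx)).2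
    refine ⟨S'.image fun x => (x.1, g x), ?_, ?_, ?_, ?_⟩
    · rw [card_image_of_injective, hc]
      intro x y hxy
      exact Subtype.ext (Prod.ext_iff.1 hxy).1
    · intro q hq
      obtain ⟨x, hx, rfl⟩ := mem_image.1 hq
      exact ⟨x.2, hg2 x (hmem x hx), hg3 x (hmem x hx)⟩
    · intro q hq q' hq' e
      obtain ⟨x, hx, rfl⟩ := mem_image.1 (mem_coe.1 hq)
      obtain ⟨x', hx', rfl⟩ := mem_image.1 (mem_coe.1 hq')
      obtain rfl : x = x' := Subtype.ext e
      rfl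
    · intro q hq q' hq' e
      obtain ⟨x, hx, rfl⟩ := mem_image.1 (mem_coe.1 hq)
      obtain ⟨x', hx', rfl⟩ := mem_image.1 (mem_coe.1 hq')
      have : x = x' := hf (by
        rw [hg1 x (hmem x hx), hg1 x' (hmem x' hx')]
        exact congrArg Sum.inl e)
      rw [this]
  · right
    push Not at hall
    obtain ⟨s, hs⟩ := hall
    let N := Y.filter fun y => ∃ x ∈ s, r x y
    have hsne : s.Nonempty := by
      rw [nonempty_iff_ne_empty]
      rintro rfl
      simp at hs
    have h1 : N.disjSum (univ : Finset (Fin d)) ⊆ s.biUnion t := by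
      intro z hz
      rw [mem_biUnion]
      rcases z with y | i
      · simp only [inl_mem_disjSum, N, mem_filter] at hz
        obtain ⟨hy, x, hx, hxy⟩ := hz
        exact ⟨x, hx, by simp [t, hy, hxy]⟩
      · obtain ⟨x, hx⟩ := hsne
        exact ⟨x, hx, by simp [t]⟩
    have h2 := card_le_card h1
    rw [card_disjSum, card_univ, Fintype.card_fin] at h2
    have h3 : s.card ≤ X.card := by
      have := card_le_univ s
      rwa [Fintype.card_coe] at this
    have h4 := card_sdiff_add_card_eq_card (filter_subset (fun y => ∃ x ∈ s, r x y) Y)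
    refine ⟨s.map (Function.Embedding.subtype _), ?_, Y \ N, sdiff_subset, ?_, ?_, ?_⟩
    · intro x hx
      obtain ⟨y, -, rfl⟩ := mem_map.1 hx
      exact y.2
    · intro x hx y hy hxy
      obtain ⟨x, hx', rfl⟩ := mem_map.1 hx
      rw [mem_sdiff] at hy
      exact hy.2 (mem_filter.2 ⟨hy.1, x, hx', hxy⟩)
    · rw [card_map]; omega
    · change (Y \ N).card + N.card = Y.card at h4
      omega

end SimpleGraph

/-! ### Exchanges that make a given vertex free -/

namespace SimpleGraph

open Finset Equiv

variable {V : Type*} {H : SimpleGraph V} {X Y : Finset V} {σ : Perm V}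

/-- `X` and `Y` are independent sets of `H` that the matching swaps, and the set `T₂` of links from
`X` to `Y` is part of the linkage `T`. -/
structure IsSidedLinkage [DecidableEq V] (H : SimpleGraph V) (X Y : Finset V)
    (T₂ : Finset (V × V)) (σ : Perm V) (T : Finset (V × V)) : Prop extends IsLinkage H σ T where
  indepX : ∀ v ∈ X, ∀ w ∈ X, ¬ H.Adj v w
  indepY : ∀ v ∈ Y, ∀ w ∈ Y, ¬ H.Adj v w
  mapX : ∀ v ∈ X, σ v ∈ Y
  mapY : ∀ v ∈ Y, σ v ∈ X
  subset : T₂ ⊆ T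
  sides : ∀ p ∈ T₂, p.1 ∈ X ∧ p.2 ∈ Y ∧ ¬ H.Adj p.1 p.2

theorem conj_apply_left [DecidableEq V] {a b : V} (h : a ≠ σ b)
    (ha : σ a ≠ a) : (swap (σ a) (σ b) * σ * swap (σ a) (σ b)) a = σ b := by
  simp only [Perm.mul_apply]
  rw [swap_apply_of_ne_of_ne ha.symm h, swap_apply_left]

theorem conj_apply_right [DecidableEq V] {a b : V} (h : b ≠ σ a)
    (hb : σ b ≠ b) : (swap (σ a) (σ b) * σ * swap (σ a) (σ b)) b = σ a := by
  simp only [Perm.mul_apply]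
  rw [swap_apply_of_ne_of_ne h hb.symm, swap_apply_right]

theorem OnLink.eq_or_eq (hP : IsPairing H σ) {p : V × V} {a b x : V} (ha : OnLink σ p a)
    (hb : OnLink σ p b) (hx : OnLink σ p x) (hax : a ≠ x) (hax' : a ≠ σ x) (hbx : b ≠ x)
    (hbx' : b ≠ σ x) : b = a ∨ b = σ a := by
  have i1 := hP.invol p.1
  have i2 := hP.invol p.2
  unfold OnLink at *
  grind

variable [DecidableEq V] {T T₂ : Finset (V × V)}

/-- Exchanging the partners of `a` and `b`. -/
theorem IsSidedLinkage.conj [Fintype V] (h : IsSidedLinkage H X Y T₂ σ T) {a b : V}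
    (hb : IsFree σ T b) (ha : a ∉ linkEnds T) (haσ : σ a ∈ linkEnds T → σ a ∈ linkEnds T₂)
    (han : σ a ≠ a) (hab : a ≠ b) (hab' : a ≠ σ b) (h1 : H.Adj a (σ b)) (h2 : H.Adj (σ a) b)
    (hside : (a ∈ X ∧ b ∈ X) ∨ (a ∈ Y ∧ b ∈ Y)) :
    IsSidedLinkage H X Y T₂ (swap (σ a) (σ b) * σ * swap (σ a) (σ b)) T := by
  have hP := h.pairing
  set ρ := swap (σ a) (σ b) * σ * swap (σ a) (σ b) with hρ
  have hba' : b ≠ σ a := fun e => hab' (by rw [e, hP.invol])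
  have ra : ρ a = σ b := conj_apply_left hab' han
  have rb : ρ b = σ a := conj_apply_right hba' hb.1
  have hρP : IsPairing H ρ := by
    refine hP.conj (by rw [hP.invol]; exact hab') (fun _ => ?_) (fun _ => ?_) <;> rw [hP.invol]
    · exact h1
    · exact h2.symm
  have raσ : ρ (σ a) = b := by rw [hρP.eq_iff, rb]
  have rbσ : ρ (σ b) = a := by rw [hρP.eq_iff, ra]
  have rel : ∀ v, v ≠ a → v ≠ b → v ≠ σ a → v ≠ σ b → ρ v = σ v := fun v n1 n2 n3 n4 =>
    conj_apply_of_ne n3 n4 (fun e => n1 (σ.injective e)) (fun e => n2 (σ.injective e))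
  have hX : ∀ v ∈ X, ρ v ∈ Y := by
    intro v hv
    by_cases n1 : v = a
    · subst n1; rw [ra]
      rcases hside with ⟨_, h4⟩ | ⟨h3, _⟩
      · exact h.mapX _ h4
      · exact absurd h1 (fun _ => absurd (hP.adj v han) (h.indepX _ hv _ (h.mapY _ h3)))
    by_cases n2 : v = b
    · subst n2; rw [rb]
      rcases hside with ⟨h3, _⟩ | ⟨_, h4⟩
      · exact h.mapX _ h3
      · exact absurd (hP.adj v hb.1) (h.indepX _ hv _ (h.mapY _ h4))
    by_cases n3 : v = σ a
    · subst n3; rw [raσ]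
      rcases hside with ⟨h3, _⟩ | ⟨_, h4⟩
      · exact absurd (hP.adj a han) (h.indepX _ h3 _ hv)
      · exact h4
    by_cases n4 : v = σ b
    · subst n4; rw [rbσ]
      rcases hside with ⟨_, h3⟩ | ⟨h4, _⟩
      · exact absurd (hP.adj b hb.1) (h.indepX _ h3 _ hv)
      · exact h4
    rw [rel v n1 n2 n3 n4]; exact h.mapX v hv
  have hY : ∀ v ∈ Y, ρ v ∈ X := by
    intro v hv
    by_cases n1 : v = a
    · subst n1; rw [ra]
      rcases hside with ⟨h3, _⟩ | ⟨_, h4⟩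
      · exact absurd (hP.adj v han) (h.indepY _ hv _ (h.mapX _ h3))
      · exact h.mapY _ h4
    by_cases n2 : v = b
    · subst n2; rw [rb]
      rcases hside with ⟨_, h4⟩ | ⟨h3, _⟩
      · exact absurd (hP.adj v hb.1) (h.indepY _ hv _ (h.mapX _ h4))
      · exact h.mapY _ h3
    by_cases n3 : v = σ a
    · subst n3; rw [raσ]
      rcases hside with ⟨_, h4⟩ | ⟨h3, _⟩
      · exact h4
      · exact absurd (hP.adj a han) (h.indepY _ h3 _ hv)
    by_cases n4 : v = σ b
    · subst n4; rw [rbσ]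
      rcases hside with ⟨h4, _⟩ | ⟨_, h3⟩
      · exact h4
      · exact absurd (hP.adj b hb.1) (h.indepY _ h3 _ hv)
    rw [rel v n1 n2 n3 n4]; exact h.mapY v hv
  have hend : ∀ v ∈ linkEnds T, v ≠ a ∧ v ≠ b ∧ v ≠ σ b := fun v hv =>
    ⟨fun e => ha (e ▸ hv), fun e => hb.2.1 (e ▸ hv), fun e => hb.2.2 (e ▸ hv)⟩
  refine ⟨⟨hρP, ?_, h.card, ?_⟩, h.indepX, h.indepY, hX, hY, h.subset, h.sides⟩
  · intro p hp
    -- A pair of `T₂` remains a link whatever the partners of its ends are, as long as the matching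
    -- swaps the independent sets `X` and `Y`. Other links keep their matching edges.
    by_cases hp2 : p ∈ T₂
    · obtain ⟨s1, s2, s3⟩ := h.sides p hp2
      exact ⟨s3, h.indepX _ s1 _ (hY _ s2), h.indepY _ (hX _ s1) _ s2⟩
    · have key : ∀ v, (v = p.1 ∨ v = p.2) → ρ v = σ v := by
        intro v hv
        have hvT := mem_linkEnds.2 ⟨p, hp, hv⟩
        obtain ⟨n1, n2, n3⟩ := hend v hvT
        refine rel v n1 n2 (fun e => hp2 ?_) n3
        obtain ⟨q, hq, hq'⟩ := mem_linkEnds.1 (haσ (e ▸ hvT))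
        rw [h.eq_of_end hp (h.subset hq) hv (e ▸ hq')]
        exact hq
      have := h.link p hp
      rwa [IsLink, ← key _ (Or.inl rfl), ← key _ (Or.inr rfl)] at this
  · intro v hv
    obtain ⟨n1, n2, n3⟩ := hend v hv
    by_cases n4 : v = σ a
    · rw [n4, raσ]; exact hb.2.1
    · rw [rel v n1 n2 n4 n3]; exact h.notMem v hv

/-- The free vertex `b` can be used to make `a` free. -/
def Frees (H : SimpleGraph V) (X Y : Finset V) (T₂ : Finset (V × V)) (σ : Perm V)
    (T : Finset (V × V)) (a b : V) : Prop :=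
  IsFree σ T b ∧ (b ∈ X ∨ b ∈ Y) ∧ (b = a ∨
    (σ a ∈ linkEnds T₂ ∧ H.Adj a (σ b) ∧ H.Adj (σ a) b ∧ ((a ∈ X ∧ b ∈ X) ∨ (a ∈ Y ∧ b ∈ Y))) ∨
    ∃ p ∈ T, p ∉ T₂ ∧ OnLink σ p a ∧ ∃ x, OnLink σ p x ∧ x ∉ X ∧ x ∉ Y ∧
      ∃ y, (y = b ∨ y = σ b) ∧ IsLink H σ x y)

/-- Three cases of `Frees`: nothing is to be done; or `a` and `b` exchange partners, so that the
link at `σ a` now uses the edge to `b`; or the link `p` is replaced by one from its edge outside `X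
∪ Y` to the edge of `b`, which releases the edge of `a`. Only the edges of `a` and `b` are affected,
apart from vertices becoming free. -/
theorem Frees.exists [Fintype V] (h : IsSidedLinkage H X Y T₂ σ T) {a b : V} (ha : a ∈ X ∨ a ∈ Y)
    (hab : Frees H X Y T₂ σ T a b) :
    ∃ σ' T', IsSidedLinkage H X Y T₂ σ' T' ∧ T'.card = T.card ∧
      (unmatched σ').card = (unmatched σ).card ∧ IsFree σ' T' a ∧
      (∀ v, v ≠ a → v ≠ σ a → v ≠ b → v ≠ σ b →
        σ' v = σ v ∧ (IsFree σ T v → IsFree σ' T' v)) ∧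
      (∀ p ∈ T, ¬ OnLink σ p a → p ∈ T') ∧ (σ a ∉ linkEnds T₂ → σ' = σ) := by
  have hP := h.pairing
  obtain ⟨hb, hbXY, rfl | ⟨h1, h2, h3, h4⟩ | ⟨p, hp, hp2, hpa, x, hpx, hxX, hxY, y, hy, hl⟩⟩ := hab
  · exact ⟨σ, T, h, rfl, rfl, hb, fun v _ _ _ _ => ⟨rfl, id⟩, fun p hp _ => hp, fun _ => rfl⟩
  · have h1T := linkEnds_mono h.subset h1
    have haT : a ∉ linkEnds T := by
      have := h.notMem _ h1T
      rwa [hP.invol] at this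
    have han : σ a ≠ a := fun e => haT (e ▸ h1T)
    have hab : a ≠ b := fun e => hb.2.2 (e ▸ h1T)
    have hab' : a ≠ σ b := fun e => hb.2.1 (by rw [e, hP.invol] at h1T; exact h1T)
    have g := h.conj hb haT (fun _ => h1) han hab hab' h2 h3 h4
    have ga : (swap (σ a) (σ b) * σ * swap (σ a) (σ b)) a = σ b := conj_apply_left hab' han
    refine ⟨_, T, g, rfl, card_unmatched_conj .., ⟨?_, haT, ?_⟩, ?_, fun p hp _ => hp,
      fun e => absurd h1 e⟩
    · rw [ga]; exact hab'.symm
    · rw [ga]; exact hb.2.2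
    · intro v n1 n2 n3 n4
      have : (swap (σ a) (σ b) * σ * swap (σ a) (σ b)) v = σ v :=
        conj_apply_of_ne n2 n4 (fun e => n1 (σ.injective e)) (fun e => n3 (σ.injective e))
      refine ⟨this, fun hv => ?_⟩
      rw [IsFree, this]
      exact hv
  · have hσx : ∀ v, (v ∈ X ∨ v ∈ Y) → v ≠ x ∧ v ≠ σ x := by
      intro v hv
      refine ⟨fun e => ?_, fun e => ?_⟩
      · rw [e] at hv; tauto
      · rw [← hP.eq_iff] at e
        rcases hv with hv | hv
        · exact hxY (e ▸ h.mapX v hv)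
        · exact hxX (e ▸ h.mapY v hv)
    have hyf : IsFree σ T y := by
      rcases hy with rfl | rfl
      exacts [hb, hb.apply hP]
    have hne : ∀ v w, OnLink σ p v → IsFree σ T w → w ≠ v ∧ w ≠ σ v := fun v w hv hw =>
      ⟨fun e => h.not_free_of_onLink hp hv (e ▸ hw),
        fun e => h.not_free_of_onLink hp (hv.apply hP) (e ▸ hw)⟩
    obtain ⟨g, gc⟩ := h.replace hp (h.free_erase hp hpx) (hyf.mono (erase_subset _ _))
      (hne _ _ hpx hyf).1 (hne _ _ hpx hyf).2 hl
    have key : ∀ v, IsFree σ (T.erase p) v → v ≠ x → v ≠ σ x → v ≠ y → v ≠ σ y →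
        IsFree σ (insert (x, y) (T.erase p)) v := by
      intro v hv e1 e2 e3 e4
      refine ⟨hv.1, ?_, ?_⟩ <;> rw [linkEnds_insert] <;> simp only [mem_insert, not_or]
      · exact ⟨e1, e3, hv.2.1⟩
      · exact ⟨fun e => e2 (hP.eq_iff.1 e), fun e => e4 (hP.eq_iff.1 e), hv.2.2⟩
    refine ⟨σ, insert (x, y) (T.erase p), ⟨g, h.indepX, h.indepY, h.mapX, h.mapY, ?_, h.sides⟩, gc,
      rfl, ?_, ?_, ?_, fun _ => rfl⟩
    · intro q hq
      exact mem_insert_of_mem (mem_erase.2 ⟨fun e => hp2 (e ▸ hq), h.subset hq⟩)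
    · have h4 := hne _ _ hpa hyf
      exact key a (h.free_erase hp hpa) (hσx a ha).1 (hσx a ha).2 h4.1.symm
        fun e => h4.2 (hP.eq_iff.1 e.symm)
    · intro v n1 n2 n3 n4
      refine ⟨rfl, fun hv => key v (hv.mono (erase_subset _ _)) (hne _ _ hpx hv).1
        (hne _ _ hpx hv).2 ?_ ?_⟩
      · rcases hy with rfl | rfl <;> assumption
      · rcases hy with rfl | rfl
        · exact n4
        · rw [hP.invol]; exact n3
    · intro q hq hqa
      exact mem_insert_of_mem (mem_erase.2 ⟨fun e => hqa (e ▸ hpa), hq⟩)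

/-- Two vertices are to be freed one after the other, so the second option must survive the first
exchange. A link `p` that serves `a'` has one edge outside `X ∪ Y`; if `a` were on `p`, it would
share the other edge with `a'`. -/
theorem Frees.persists (h : IsSidedLinkage H X Y T₂ σ T) {σ' : Perm V} {T' : Finset (V × V)}
    {a b a' b' : V} (ha : a ∈ X ∨ a ∈ Y) (hb : IsFree σ T b) (hbXY : b ∈ X ∨ b ∈ Y)
    (hσ' : ∀ v, v ≠ a → v ≠ σ a → v ≠ b → v ≠ σ b →
        σ' v = σ v ∧ (IsFree σ T v → IsFree σ' T' v))
    (hT' : ∀ p ∈ T, ¬ OnLink σ p a → p ∈ T') (ha' : a' ∈ X ∨ a' ∈ Y)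
    (hf : Frees H X Y T₂ σ T a' b')
    (n1 : a' ≠ a) (n2 : a' ≠ σ a) (n3 : a' ≠ b) (n4 : a' ≠ σ b)
    (m1 : b' ≠ a) (m2 : b' ≠ σ a) (m3 : b' ≠ b) (m4 : b' ≠ σ b) :
    Frees H X Y T₂ σ' T' a' b' := by
  have hP := h.pairing
  have ea := (hσ' a' n1 n2 n3 n4).1
  have eb := (hσ' b' m1 m2 m3 m4).1
  obtain ⟨hb', hbXY', h1⟩ := hf
  refine ⟨(hσ' b' m1 m2 m3 m4).2 hb', hbXY', ?_⟩
  rcases h1 with h1 | h1 | ⟨p, hp, hp2, hpa, x, hpx, hxX, hxY, y, hy, hl⟩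
  · exact Or.inl h1
  · right; left
    rwa [ea, eb]
  · right; right
    have hσx : ∀ v, (v ∈ X ∨ v ∈ Y) → v ≠ x ∧ v ≠ σ x := by
      intro v hv
      refine ⟨fun e => ?_, fun e => ?_⟩
      · rw [e] at hv; tauto
      · rw [← hP.eq_iff] at e
        rcases hv with hv | hv
        · exact hxY (e ▸ h.mapX v hv)
        · exact hxX (e ▸ h.mapY v hv)
    have hpna : ¬ OnLink σ p a := by
      intro hh
      rcases OnLink.eq_or_eq hP hpa hh hpx (hσx _ ha').1 (hσx _ ha').2 (hσx _ ha).1 (hσx _ ha).2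
        with e | e
      · exact n1 e.symm
      · rw [← hP.eq_iff] at e; exact n2 e.symm
    have hsame : ∀ v, OnLink σ p v → σ' v = σ v := by
      intro v hv
      refine (hσ' v ?_ ?_ ?_ ?_).1
      · rintro rfl; exact hpna hv
      · rintro rfl; exact hpna (by have := hv.apply hP; rwa [hP.invol] at this)
      · rintro rfl; exact h.not_free_of_onLink hp hv hb
      · rintro rfl; exact h.not_free_of_onLink hp hv (hb.apply hP)
    have e1 := hsame p.1 (Or.inl rfl)
    have e2 := hsame p.2 (Or.inr (Or.inr (Or.inl rfl)))
    refine ⟨p, hT' p hp hpna, hp2, ?_, x, ?_, hxX, hxY, y, by rwa [eb], ?_⟩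
    · rw [OnLink, e1, e2]; exact hpa
    · rw [OnLink, e1, e2]; exact hpx
    · have ey : σ' y = σ y := by
        rcases hy with rfl | rfl
        · exact eb
        · refine (hσ' _ ?_ ?_ ?_ ?_).1
          · exact fun e => m2 (hP.eq_iff.1 e)
          · exact fun e => m1 (σ.injective e)
          · exact fun e => m4 (hP.eq_iff.1 e)
          · exact fun e => m3 (σ.injective e)
      rw [IsLink, ey, hsame x hpx]; exact hl

/-- Exchanging the links `T₂` for a larger matching between `X` and `Y`. -/
theorem IsSidedLinkage.exists_larger (h : IsSidedLinkage H X Y T₂ σ T) {F : Finset (V × V)}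
    {a b : V} (ha : IsFree σ T a) (hb : IsFree σ T b) (hab : a ≠ b) (hab' : σ a ≠ b)
    (hF : ∀ q ∈ F, q.1 ∈ X ∧ q.2 ∈ Y ∧ ¬ H.Adj q.1 q.2) (hFc : F.card = T₂.card + 1)
    (h1 : F.image Prod.fst = insert a (T₂.image Prod.fst))
    (h2 : F.image Prod.snd = insert b (T₂.image Prod.snd)) :
    ∃ T', IsLinkage H σ T' ∧ T'.card = T.card + 1 := by
  have hP := h.pairing
  have hFe : linkEnds F = insert a (insert b (linkEnds T₂)) := by
    rw [linkEnds, h1, h2, linkEnds]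
    ext v; simp only [mem_union, mem_insert]; tauto
  -- The new pairs reuse all ends of `T₂`, so only `a` and `b` are new ends. Being nonadjacent pairs
  -- between `X` and `Y`, they are links automatically.
  have hE : linkEnds (T \ T₂ ∪ F) = insert a (insert b (linkEnds T)) := by
    have h3 : linkEnds T = linkEnds (T \ T₂) ∪ linkEnds T₂ := by
      rw [← linkEnds_union, sdiff_union_of_subset h.subset]
    rw [linkEnds_union, hFe, h3]
    ext v; simp only [mem_union, mem_insert]; tauto
  have hEc : (linkEnds (T \ T₂ ∪ F)).card = (linkEnds T).card + 2 := by
    rw [hE, card_insert_of_notMem, card_insert_of_notMem hb.2.1]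
    simp [hab, ha.2.1]
  have hc1 := card_union_le (T \ T₂) F
  have hc2 := card_sdiff_add_card_eq_card h.subset
  have hc3 := card_linkEnds_le (T \ T₂ ∪ F)
  have hc4 := h.card
  refine ⟨T \ T₂ ∪ F, ⟨hP, ?_, by omega, ?_⟩, by omega⟩
  · intro q hq
    rcases mem_union.1 hq with hq | hq
    · exact h.link q (mem_sdiff.1 hq).1
    · obtain ⟨s1, s2, s3⟩ := hF q hq
      exact ⟨s3, h.indepX _ s1 _ (h.mapY _ s2), h.indepY _ (h.mapX _ s1) _ s2⟩
  · intro v hv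
    rw [hE] at hv ⊢
    simp only [mem_insert, not_or] at hv ⊢
    rcases hv with rfl | rfl | hv
    · exact ⟨ha.1, hab', ha.2.2⟩
    · exact ⟨fun e => hab' (by rw [← e, hP.invol]), hb.1, hb.2.2⟩
    · exact ⟨fun e => ha.2.2 (by rw [← e, hP.invol]; exact hv),
        fun e => hb.2.2 (by rw [← e, hP.invol]; exact hv), h.notMem v hv⟩

end SimpleGraph

namespace SimpleGraph

open Finset Equiv

variable {V : Type*} {H : SimpleGraph V} {σ : Perm V}

theorem mem_map_pairing (hP : IsPairing H σ) {X : Finset V} {v : V} :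
    v ∈ X.map σ.toEmbedding ↔ σ v ∈ X := by
  have hs : σ.symm v = σ v := by rw [symm_apply_eq, hP.invol]
  rw [mem_map_equiv, hs]

variable [DecidableEq V] {T : Finset (V × V)} {A : Finset V}

/-- A vertex that is already free must use itself. Any other vertex has options on two different
edges, one of which avoids the edge chosen for its competitor. -/
theorem exists_disjoint_frees (hP : IsPairing H σ) {X Y : Finset V} {T₂ : Finset (V × V)}
    {a b : V}
    (hab : a ≠ b) (hσab : σ a ≠ b)
    (ha : (IsFree σ T a ∧ Frees H X Y T₂ σ T a a) ∨ (¬ IsFree σ T a ∧ ∃ b c, c ≠ b ∧ c ≠ σ b ∧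
      Frees H X Y T₂ σ T a b ∧ Frees H X Y T₂ σ T a c))
    (hb : (IsFree σ T b ∧ Frees H X Y T₂ σ T b b) ∨ (¬ IsFree σ T b ∧ ∃ c d, d ≠ c ∧ d ≠ σ c ∧
      Frees H X Y T₂ σ T b c ∧ Frees H X Y T₂ σ T b d)) :
    ∃ c d, Frees H X Y T₂ σ T a c ∧
      Frees H X Y T₂ σ T b d ∧ (IsFree σ T a → c = a) ∧ (IsFree σ T b → d = b) ∧
      d ≠ c ∧ d ≠ σ c := by
  have pick : ∀ v c d, d ≠ c → d ≠ σ c → (c ≠ v ∧ c ≠ σ v) ∨ (d ≠ v ∧ d ≠ σ v) := by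
    intro v c d h1 h2
    by_contra hcon
    have e1 : c = v ∨ c = σ v := by tauto
    have e2 : d = v ∨ d = σ v := by tauto
    rcases e1 with rfl | rfl <;> rcases e2 with rfl | rfl
    · exact h1 rfl
    · exact h2 rfl
    · rw [hP.invol] at h2; exact h2 rfl
    · exact h1 rfl
  have pick' : ∀ v x, (¬ IsFree σ T x ∧ ∃ b c, c ≠ b ∧ c ≠ σ b ∧ Frees H X Y T₂ σ T x b ∧
      Frees H X Y T₂ σ T x c) → ∃ d, Frees H X Y T₂ σ T x d ∧ (IsFree σ T x → d = x) ∧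
      d ≠ v ∧ d ≠ σ v := by
    rintro v x ⟨h1, c, d, h2, h3, h4, h5⟩
    rcases pick v c d h2 h3 with h6 | h6
    · exact ⟨c, h4, fun e => absurd e h1, h6⟩
    · exact ⟨d, h5, fun e => absurd e h1, h6⟩
  rcases hb with ⟨h1, h2⟩ | h1
  · rcases ha with ⟨h3, h4⟩ | h3
    · exact ⟨a, b, h4, h2, fun _ => rfl, fun _ => rfl, hab.symm, fun e => hσab e.symm⟩
    · obtain ⟨c, k1, k2, k3, k4⟩ := pick' b a h3
      exact ⟨c, b, k1, h2, k2, fun _ => rfl, k3.symm, fun e => k4 (hP.eq_iff.1 e.symm)⟩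
  · obtain ⟨c, k1, k2⟩ : ∃ c, Frees H X Y T₂ σ T a c ∧ (IsFree σ T a → c = a) := by
      rcases ha with ⟨h1, h2⟩ | ⟨h1, c, -, -, -, h2, -⟩
      · exact ⟨a, h2, fun _ => rfl⟩
      · exact ⟨c, h2, fun e => absurd e h1⟩
    obtain ⟨d, k3, k4, k5, k6⟩ := pick' c b h1
    exact ⟨c, d, k1, k3, k2, k4, k5, k6⟩

variable [Fintype V]

/-- The links between the extended side of `A` and its image under the matching. -/
noncomputable def sideLinks (H : SimpleGraph V) (σ : Perm V) (A : Finset V)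
    (T : Finset (V × V)) : Finset (V × V) :=
  T.filter fun p => p.1 ∈ extendedSide H σ A ∧ σ p.2 ∈ extendedSide H σ A

theorem IsLinkage.isSidedLinkage (h : IsLinkage H σ T)
    (htri : ∀ a b c, H.Adj a b → H.Adj b c → ¬ H.Adj a c) (hA3 : 3 ≤ A.card) :
    IsSidedLinkage H (extendedSide H σ A) ((extendedSide H σ A).map σ.toEmbedding)
      (sideLinks H σ A T) σ T := by
  have hP := h.pairing
  refine ⟨h, ?_, ?_, ?_, ?_, filter_subset _ _, ?_⟩
  · exact fun v hv w hw => (extendedSide_not_adj htri hA3 hv hw).1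
  · intro v hv w hw
    rw [mem_map_pairing hP] at hv hw
    have := (extendedSide_not_adj htri hA3 hv hw).2
    rwa [hP.invol, hP.invol] at this
  · intro v hv
    rw [mem_map_pairing hP, hP.invol]
    exact hv
  · intro v hv
    exact (mem_map_pairing hP).1 hv
  · intro p hp
    obtain ⟨h1, h2, h3⟩ := mem_filter.1 hp
    exact ⟨h2, (mem_map_pairing hP).2 h3, (h.link p h1).1⟩

/-- If the link at `a` is a side link, its end is `σ a`, and `a` can exchange partners with every
edge of `A` but one, so with at least two. Otherwise one edge of the link lies outside the extended
sides, and it can be linked to two free edges instead. -/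
theorem IsLinkage.exists_frees (h : IsLinkage H σ T)
    (htri : ∀ a b c, H.Adj a b → H.Adj b c → ¬ H.Adj a c) (hA : IsFreeSide H σ T A)
    (hA3 : 3 ≤ A.card) (hor : ∀ p ∈ T,
      (p.1 ∈ extendedSide H σ A ∨ σ p.1 ∈ extendedSide H σ A) →
      (p.2 ∈ extendedSide H σ A ∨ σ p.2 ∈ extendedSide H σ A) →
      p.1 ∈ extendedSide H σ A ∧ σ p.2 ∈ extendedSide H σ A)
    {a : V} (ha : a ∈ extendedSide H σ A ∨ a ∈ (extendedSide H σ A).map σ.toEmbedding)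
    (haT : a ∉ linkEnds (sideLinks H σ A T)) :
    (IsFree σ T a ∧ Frees H (extendedSide H σ A) ((extendedSide H σ A).map σ.toEmbedding)
      (sideLinks H σ A T) σ T a a) ∨
    (¬ IsFree σ T a ∧ ∃ b c, c ≠ b ∧ c ≠ σ b ∧
      Frees H (extendedSide H σ A) ((extendedSide H σ A).map σ.toEmbedding)
        (sideLinks H σ A T) σ T a b ∧
      Frees H (extendedSide H σ A) ((extendedSide H σ A).map σ.toEmbedding)
        (sideLinks H σ A T) σ T a c) := by
  have hP := h.pairing
  set X := extendedSide H σ A with hX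
  set Y := X.map σ.toEmbedding with hY
  have hmY : ∀ v, v ∈ Y ↔ σ v ∈ X := fun v => mem_map_pairing hP
  by_cases hfree : IsFree σ T a
  · exact Or.inl ⟨hfree, hfree, ha, Or.inl rfl⟩
  refine Or.inr ⟨hfree, ?_⟩
  have hAX : ∀ v ∈ A, v ∈ X := fun v hv => hA.subset_extendedSide hv
  have ha' : a ∈ X ∨ σ a ∈ X := by rwa [← hmY]
  have han : σ a ≠ a := by
    rcases ha' with h1 | h1
    · exact extendedSide_apply_ne htri hA hA3 h1
    · exact fun e => extendedSide_apply_ne htri hA hA3 h1 (by rw [e, e])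
  obtain ⟨p, hp, hpa⟩ := (h.free_or han).resolve_left hfree
  by_cases hp2 : p ∈ sideLinks H σ A T
  · have haσ : σ a ∈ linkEnds (sideLinks H σ A T) := by
      rcases hpa with rfl | rfl | rfl | rfl
      · exact absurd (fst_mem_linkEnds hp2) haT
      · rw [hP.invol]; exact fst_mem_linkEnds hp2
      · exact absurd (snd_mem_linkEnds hp2) haT
      · rw [hP.invol]; exact snd_mem_linkEnds hp2
    rcases ha' with h1 | h1
    · obtain ⟨j, hj, hj'⟩ := mem_extendedSide.1 h1
      obtain ⟨b, hb, hbj, -⟩ := exists_mem_ne_ne hA3 j j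
      obtain ⟨c, hc, hcj, hcb⟩ := exists_mem_ne_ne hA3 j b
      have key : ∀ b ∈ A, b ≠ j → Frees H X Y (sideLinks H σ A T) σ T a b := fun b hb hbj =>
        ⟨hA.free b hb, Or.inl (hAX b hb), Or.inr (Or.inl ⟨haσ, (hj' b hb hbj).1, (hj' b hb hbj).2,
          Or.inl ⟨h1, hAX b hb⟩⟩)⟩
      exact ⟨b, c, hcb, fun e => hA.notMem b hb (e ▸ hc), key b hb hbj, key c hc hcj⟩
    · obtain ⟨j, hj, hj'⟩ := mem_extendedSide.1 h1
      obtain ⟨b, hb, hbj, -⟩ := exists_mem_ne_ne hA3 j j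
      obtain ⟨c, hc, hcj, hcb⟩ := exists_mem_ne_ne hA3 j b
      have key : ∀ b ∈ A, b ≠ j → Frees H X Y (sideLinks H σ A T) σ T a (σ b) := by
        intro b hb hbj
        have hbY : σ b ∈ Y := by rw [hmY, hP.invol]; exact hAX b hb
        have := hj' b hb hbj
        rw [hP.invol] at this
        refine ⟨(hA.free b hb).apply hP, Or.inr hbY, Or.inr (Or.inl ⟨haσ, ?_, this.1,
          Or.inr ⟨(hmY a).2 h1, hbY⟩⟩)⟩
        rw [hP.invol]; exact this.2
      refine ⟨σ b, σ c, fun e => hcb (σ.injective e), fun e => ?_, key b hb hbj, key c hc hcj⟩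
      rw [hP.invol] at e
      exact hA.notMem c hc (e ▸ hb)
  · have hone : ∃ x, (x = p.1 ∨ x = p.2) ∧ ¬ (x ∈ X ∨ σ x ∈ X) := by
      by_contra hc
      push Not at hc
      exact hp2 (mem_filter.2 ⟨hp, hor p hp (hc _ (Or.inl rfl)) (hc _ (Or.inr rfl))⟩)
    obtain ⟨x, hx, hxX⟩ := hone
    have hpx : OnLink σ p x := by unfold OnLink; tauto
    obtain ⟨b, hb, c, hc, hbc, hsb, hsc⟩ := exists_two_not_isSquare hP htri hA hA3 hxX
    have hxn := h.onLink_ne hp hpx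
    have key : ∀ b ∈ A, ¬ IsSquare H σ x b → Frees H X Y (sideLinks H σ A T) σ T a b := by
      intro b hb hsb
      obtain ⟨v, w, hv, hw, hl⟩ := exists_link_of_not_square htri hP hxn (hA.free b hb).1 hsb
      refine ⟨hA.free b hb, Or.inl (hAX b hb), Or.inr (Or.inr ⟨p, hp, hp2, hpa, v, ?_, ?_, ?_, w,
        hw, hl⟩)⟩
      · rcases hv with rfl | rfl
        exacts [hpx, hpx.apply hP]
      · rcases hv with rfl | rfl <;> tauto
      · rw [hmY]
        rcases hv with rfl | rfl
        · tauto
        · rw [hP.invol]; tauto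
    exact ⟨b, c, hbc.symm, fun e => hA.notMem b hb (e ▸ hc), key b hb hsb, key c hc hsc⟩

theorem IsSidedLinkage.exists_free_pair {X Y : Finset V} {T₂ : Finset (V × V)}
    (hs : IsSidedLinkage H X Y T₂ σ T) {a b : V} (haX : a ∈ X) (hbY : b ∈ Y)
    (hab : a ≠ b) (hσab : σ a ≠ b)
    (ha : (IsFree σ T a ∧ Frees H X Y T₂ σ T a a) ∨ (¬ IsFree σ T a ∧ ∃ b c, c ≠ b ∧ c ≠ σ b ∧
      Frees H X Y T₂ σ T a b ∧ Frees H X Y T₂ σ T a c))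
    (hb : (IsFree σ T b ∧ Frees H X Y T₂ σ T b b) ∨ (¬ IsFree σ T b ∧ ∃ c d, d ≠ c ∧ d ≠ σ c ∧
      Frees H X Y T₂ σ T b c ∧ Frees H X Y T₂ σ T b d)) :
    ∃ σ' T', IsSidedLinkage H X Y T₂ σ' T' ∧ T'.card = T.card ∧
      (unmatched σ').card = (unmatched σ).card ∧ IsFree σ' T' a ∧ IsFree σ' T' b ∧ σ' a ≠ b := by
  have hP := hs.pairing
  -- The helpers `c` of `a` and `d` of `b` lie on different matching edges. So the vertices are
  -- freed independently: `a` first, then `b`.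
  obtain ⟨c, d, hac, hbd, hcf, hdf, hdc, hdc'⟩ := exists_disjoint_frees hP hab hσab ha hb
  have hba' : b ≠ σ a := fun e => hσab e.symm
  have hbσ : ∀ v w, v ≠ w → v ≠ σ w → w ≠ v ∧ w ≠ σ v := fun v w h1 h2 =>
    ⟨h1.symm, fun e => h2 (hP.eq_iff.1 e.symm)⟩
  have hsep : ∀ x y v w, Frees H X Y T₂ σ T x y → (IsFree σ T w → v = w) → y ≠ v → y ≠ σ v →
      y ≠ w ∧ y ≠ σ w := by
    intro x y v w h1 h2 h3 h4
    by_cases hw : IsFree σ T w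
    · rw [← h2 hw]; exact ⟨h3, h4⟩
    · exact ⟨fun e => hw (e ▸ h1.1), fun e => hw (by
        have := h1.1.apply hP
        rwa [e, hP.invol] at this)⟩
  have hda := hsep b d c a hbd hcf hdc hdc'
  have hcd := hbσ _ _ hdc hdc'
  have hcb := hsep a c d b hac hdf hcd.1 hcd.2
  have hbc := hbσ _ _ hcb.1 hcb.2
  obtain ⟨σ', T', g1, g2, g3, g4, g5, g6, -⟩ := hac.exists hs (Or.inl haX)
  have hbd' := hbd.persists hs (Or.inl haX) hac.1 hac.2.1 g5 g6 (Or.inr hbY) hab.symm hba'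
    hbc.1 hbc.2 hda.1 hda.2 hdc hdc'
  have eb := (g5 b hab.symm hba' hbc.1 hbc.2).1
  have ed := (g5 d hda.1 hda.2 hdc hdc').1
  obtain ⟨σ'', T'', k1, k2, k3, k4, k5, -, -⟩ := hbd'.exists g1 (Or.inr hbY)
  have had := hbσ _ _ hda.1 hda.2
  have hab2 := hbσ _ _ hab.symm hba'
  have ea := k5 a hab2.1 (by rw [eb]; exact hab2.2) had.1 (by rw [ed]; exact had.2)
  refine ⟨σ'', T'', k1, k2.trans g2, k3.trans g3, ea.2 g4, k4, ?_⟩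
  rw [ea.1]
  intro e
  rw [g1.pairing.eq_iff, eb] at e
  exact hab2.2 e

/-- In a maximal linkage, there is no matching between the sides that is larger than the set of
links between them. -/
theorem IsLinkage.card_ne_of_maximal (h : IsLinkage H σ T)
    (htri : ∀ a b c, H.Adj a b → H.Adj b c → ¬ H.Adj a c)
    (hmax : ∀ σ' T', IsLinkage H σ' T' → (unmatched σ').card = (unmatched σ).card →
      T'.card ≤ T.card)
    (hA : IsFreeSide H σ T A) (hA3 : 3 ≤ A.card) (hor : ∀ p ∈ T,
      (p.1 ∈ extendedSide H σ A ∨ σ p.1 ∈ extendedSide H σ A) →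
      (p.2 ∈ extendedSide H σ A ∨ σ p.2 ∈ extendedSide H σ A) →
      p.1 ∈ extendedSide H σ A ∧ σ p.2 ∈ extendedSide H σ A)
    {F : Finset (V × V)} (hF : ∀ q ∈ F, q.1 ∈ extendedSide H σ A ∧
      q.2 ∈ (extendedSide H σ A).map σ.toEmbedding ∧ ¬ H.Adj q.1 q.2)
    (hF1 : Set.InjOn Prod.fst (F : Set (V × V))) (hF2 : Set.InjOn Prod.snd (F : Set (V × V))) :
    F.card ≠ (sideLinks H σ A T).card + 1 := by
  intro hFc
  have hP := h.pairing
  have hs := h.isSidedLinkage htri hA3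
  have hfr := fun a => h.exists_frees htri hA hA3 hor (a := a)
  have hAX : ∀ v ∈ A, v ∈ extendedSide H σ A := fun v hv => hA.subset_extendedSide hv
  have hexc : ∀ a ∈ extendedSide H σ A, ∃ j ∈ A, ∀ j' ∈ A, j' ≠ j →
      H.Adj a (σ j') ∧ H.Adj (σ a) j' := fun a ha => mem_extendedSide.1 ha
  have hXn : ∀ v ∈ extendedSide H σ A, σ v ∉ extendedSide H σ A := fun v hv =>
    extendedSide_notMem hP htri hA hA3 hv
  set X := extendedSide H σ A with hX
  set Y := X.map σ.toEmbedding with hY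
  set T₂ := sideLinks H σ A T with hT₂
  have hmY : ∀ v, v ∈ Y ↔ σ v ∈ X := fun v => mem_map_pairing hP
  have hXY : ∀ v ∈ X, v ∉ Y := fun v hv hv' => hXn v hv ((hmY v).1 hv')
  have hT₂i : ∀ p ∈ T₂, ∀ q ∈ T₂, ∀ v, (v = p.1 ∨ v = p.2) → (v = q.1 ∨ v = q.2) → p = q :=
    fun p hp q hq v h1 h2 => h.eq_of_end (hs.subset hp) (hs.subset hq) h1 h2
  -- Augmenting keeps all ends of `T₂` in use and adds one `a` in `X` and one `b` in `Y`. It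
  -- suffices to make these free on different matching edges without losing `T₂`.
  obtain ⟨F₁, hF₁, a, b, hc, haT, hbT, hfst, hsnd⟩ := exists_augmented_matching F.card T₂ F rfl
    (by omega) (fun p hp q hq e => hT₂i p hp q hq p.1 (Or.inl rfl) (Or.inl e))
    (fun p hp q hq e => hT₂i p hp q hq p.2 (Or.inr rfl) (Or.inr e)) hF1 hF2
  have hF₁s : ∀ q ∈ F₁, q.1 ∈ X ∧ q.2 ∈ Y ∧ ¬ H.Adj q.1 q.2 := fun q hq =>
    (mem_union.1 (hF₁ hq)).elim (hs.sides q) (hF q)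
  have haX : a ∈ X := by
    obtain ⟨q, hq, rfl⟩ := mem_image.1 (hfst ▸ mem_insert_self a _ : a ∈ F₁.image Prod.fst)
    exact (hF₁s q hq).1
  have hbY : b ∈ Y := by
    obtain ⟨q, hq, rfl⟩ := mem_image.1 (hsnd ▸ mem_insert_self b _ : b ∈ F₁.image Prod.snd)
    exact (hF₁s q hq).2.1
  have haE : a ∉ linkEnds T₂ := by
    rw [linkEnds, mem_union, not_or]
    refine ⟨haT, fun e => ?_⟩
    obtain ⟨q, hq, rfl⟩ := mem_image.1 e
    exact hXY _ haX (hs.sides q hq).2.1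
  have hbE : b ∉ linkEnds T₂ := by
    rw [linkEnds, mem_union, not_or]
    refine ⟨fun e => ?_, hbT⟩
    obtain ⟨q, hq, rfl⟩ := mem_image.1 e
    exact hXY _ (hs.sides q hq).1 hbY
  have hab : a ≠ b := fun e => hXY a haX (e ▸ hbY)
  have ha := hfr a (Or.inl haX) haE
  have hb := hfr b (Or.inr hbY) hbE
  suffices hgoal : ∃ σ' T', IsSidedLinkage H X Y T₂ σ' T' ∧ T'.card = T.card ∧
      (unmatched σ').card = (unmatched σ).card ∧ IsFree σ' T' a ∧ IsFree σ' T' b ∧ σ' a ≠ b by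
    obtain ⟨σ', T', g1, g2, g3, g4, g5, g6⟩ := hgoal
    obtain ⟨T'', k1, k2⟩ := g1.exists_larger g4 g5 hab g6 hF₁s hc hfst hsnd
    have := hmax σ' T'' k1 g3
    omega
  -- If `a` and `b` are partners, one exchange makes the edge `a b` free. It leaves `σ` unchanged,
  -- because `b` is not an end of `T₂`.
  by_cases hσab : σ a = b
  · obtain ⟨c, hac, hcf⟩ : ∃ c, Frees H X Y T₂ σ T a c ∧ (IsFree σ T a → c = a) := by
      rcases ha with ⟨h1, h2⟩ | ⟨h1, c, -, -, -, h2, -⟩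
      · exact ⟨a, h2, fun _ => rfl⟩
      · exact ⟨c, h2, fun e => absurd e h1⟩
    have hcfree := hac.1
    obtain ⟨σ', T', g1, g2, g3, g4, g5, -, g7⟩ := hac.exists hs (Or.inl haX)
    obtain rfl : σ' = σ := g7 (by rw [hσab]; exact hbE)
    obtain ⟨j, hj, hj'⟩ := hexc a haX
    obtain ⟨i, hi, hic⟩ : ∃ i ∈ A, i = c ∨ i = σ' c := by
      rcases hA.cover c hcfree with h1 | h1
      exacts [⟨c, h1, Or.inl rfl⟩, ⟨_, h1, Or.inr rfl⟩]
    -- The vertex `d` avoids the exceptional element `j` of `a` and the edge used to free `a`.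
    -- Exchanging partners with `d` then separates `a` from `b`, both still free.
    obtain ⟨d, hd, hdj, hdi⟩ := exists_mem_ne_ne hA3 j i
    have hdi' : d ≠ σ' i := fun e => hA.notMem i hi (e ▸ hd)
    have hdc : d ≠ c ∧ d ≠ σ' c := by
      rcases hic with rfl | rfl
      · exact ⟨hdi, hdi'⟩
      · rw [hP.invol] at hdi'; exact ⟨hdi', hdi⟩
    have hda : d ≠ a ∧ d ≠ σ' a := by
      by_cases hfa : IsFree σ' T a
      · rw [← hcf hfa]; exact hdc
      · exact ⟨fun e => hfa (e ▸ hA.free d hd), fun e => hfa (by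
          have := (hA.free d hd).apply hP
          rwa [e, hP.invol] at this)⟩
    have hdf := (g5 d hda.1 hda.2 hdc.1 hdc.2).2 (hA.free d hd)
    have hda' : a ≠ σ' d := fun e => hda.2 (hP.eq_iff.1 e.symm)
    have k := g1.conj hdf g4.2.1 (fun e => absurd e g4.2.2) g4.1 hda.1.symm hda' (hj' d hd hdj).1
      (hj' d hd hdj).2 (Or.inl ⟨haX, hAX d hd⟩)
    have ka := conj_apply_left hda' g4.1
    have kd := conj_apply_right hda.2 hdf.1
    have kb : (swap (σ' a) (σ' d) * σ' * swap (σ' a) (σ' d)) b = d := by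
      rw [k.pairing.eq_iff, kd, hσab]
    refine ⟨_, T', k, g2, by rw [card_unmatched_conj], ⟨?_, g4.2.1, ?_⟩, ⟨?_, ?_, ?_⟩, ?_⟩
    · rw [ka]; exact hda'.symm
    · rw [ka]; exact hdf.2.2
    · rw [kb, ← hσab]; exact hda.2
    · rw [← hσab]; exact g4.2.2
    · rw [kb]; exact hdf.2.1
    · rw [ka, ← hσab]; exact fun e => hda.1 (σ'.injective e)
  · exact hs.exists_free_pair haX hbY hab hσab ha hb

end SimpleGraph

/-! ### Star models in complements of matching-critical triangle-free graphs -/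

namespace SimpleGraph

open Finset Equiv

variable {V : Type*} [DecidableEq V] {H : SimpleGraph V}

/-- A set `Z` and a set `C ⊇ Z` of vertices without `H`-neighbours in `Z` contain a complete
bipartite subgraph of the complement of `H`. -/
theorem hasStarModel_of_indep {Z C : Finset V} (hC : ∀ v ∈ C, ∀ w ∈ Z, ¬ H.Adj v w) (hZC : Z ⊆ C) {ℓ k : ℕ} (hℓ : ℓ ≤ Z.card)
    (hk : k ≤ C.card) : HasStarModel Hᶜ ℓ (k - ℓ) := by
  obtain ⟨A, hAZ, hA⟩ := exists_subset_card_eq hℓ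
  have hB : k - ℓ ≤ (C \ A).card := by
    have := card_sdiff_add_card_eq_card (hAZ.trans hZC)
    omega
  refine IsStarModel.hasStarModel (ι := A) (c := Subtype.val) (S := fun _ => ∅) (B := C \ A)
    ⟨?_, ?_, ?_, ?_⟩ (by simpa using hA) hB
  · simp
  · intro i j v hi hj
    simp only [notMem_empty, or_false] at hi hj
    exact Subtype.ext (hi.symm.trans hj)
  · intro i v hi
    simp only [notMem_empty, or_false] at hi
    simp [hi]
  · intro i b hb
    rw [mem_sdiff] at hb
    refine Or.inr ⟨rfl, ?_⟩
    rw [compl_adj]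
    exact ⟨fun e => hb.2 (e ▸ i.2), fun e => hC b hb.1 i (hAZ i.2) e.symm⟩

variable [Fintype V] {σ : Perm V} {T : Finset (V × V)}

/-- Every vertex lies in `CX` or `CY`, as there are no triangles. The vertices outside `CX ∩ CY` lie
in one component, so by Gallai's lemma at least `e - 1` missed vertices lie in both sets. Hence the
two sizes add up to at least n + e - 1 = 2k - 1, and one of them is at least `k`. -/
theorem IsMatchingCritical.hasStarModel_of_complete {e : ℕ} (hH : IsMatchingCritical H e)
    (htri : ∀ a b c, H.Adj a b → H.Adj b c → ¬ H.Adj a c) (hP : IsPairing H σ)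
    (hσe : (unmatched σ).card = e) {ℓ k : ℕ} (hn : Fintype.card V + e = 2 * k) {X Y : Finset V}
    (hXY : ∀ x ∈ X, ∀ y ∈ Y, H.Adj x y) (hX : X.Nonempty) (hY : Y.Nonempty) (hXℓ : ℓ ≤ X.card)
    (hYℓ : ℓ ≤ Y.card) : HasStarModel Hᶜ ℓ (k - ℓ) := by
  classical
  obtain ⟨x₀, hx₀⟩ := hX
  obtain ⟨y₀, hy₀⟩ := hY
  have iX : ∀ v ∈ X, ∀ w ∈ X, ¬ H.Adj v w := fun v hv w hw =>
    htri _ _ _ (hXY v hv y₀ hy₀) (hXY w hw y₀ hy₀).symm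
  have iY : ∀ v ∈ Y, ∀ w ∈ Y, ¬ H.Adj v w := fun v hv w hw =>
    htri _ _ _ (hXY x₀ hx₀ v hv).symm (hXY x₀ hx₀ w hw)
  let CX := univ.filter fun v => ∀ w ∈ X, ¬ H.Adj v w
  let CY := univ.filter fun v => ∀ w ∈ Y, ¬ H.Adj v w
  have hCX : ∀ v, v ∈ CX ↔ ∀ w ∈ X, ¬ H.Adj v w := fun v => by simp [CX]
  have hCY : ∀ v, v ∈ CY ↔ ∀ w ∈ Y, ¬ H.Adj v w := fun v => by simp [CY]
  have hun : CX ∪ CY = univ := by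
    ext v
    simp only [mem_union, mem_univ, iff_true, hCX, hCY]
    by_contra hc
    push Not at hc
    obtain ⟨⟨x, hx, hvx⟩, y, hy, hvy⟩ := hc
    exact htri _ _ _ hvx (hXY x hx y hy) hvy
  have hreach : ∀ v, v ∉ CX ∩ CY → H.Reachable v x₀ := by
    intro v hv
    rw [mem_inter, hCX, hCY] at hv
    have : (∃ x ∈ X, H.Adj v x) ∨ ∃ y ∈ Y, H.Adj v y := by
      by_contra hc
      push Not at hc
      exact hv hc
    rcases this with ⟨x, hx, h⟩ | ⟨y, hy, h⟩
    · exact h.reachable.trans ((hXY x hx y₀ hy₀).reachable.trans (hXY x₀ hx₀ y₀ hy₀).symm.reachable)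
    · exact h.reachable.trans (hXY x₀ hx₀ y hy).symm.reachable
  have hone : (unmatched σ \ (CX ∩ CY)).card ≤ 1 := by
    rw [card_le_one]
    intro u hu v hv
    rw [mem_sdiff, mem_unmatched] at hu hv
    exact hH.eq_of_reachable ((hreach u hu.2).trans (hreach v hv.2).symm) hP hσe hu.1 hv.1
  have h1 := card_union_add_card_inter CX CY
  rw [hun, card_univ] at h1
  have h2 := card_sdiff_add_card_inter (unmatched σ) (CX ∩ CY)
  have h3 := card_le_card (inter_subset_right (s₁ := unmatched σ) (s₂ := CX ∩ CY))
  by_cases hk : k ≤ CX.card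
  · exact hasStarModel_of_indep (fun v hv => (hCX v).1 hv) (fun v hv => (hCX v).2 (iX v hv))
      hXℓ hk
  · exact hasStarModel_of_indep (fun v hv => (hCY v).1 hv) (fun v hv => (hCY v).2 (iY v hv))
      hYℓ (by omega)

/-- One of the two ends of a matching edge has no neighbours among the uncovered vertices. -/
theorem IsMatchingCritical.apart_or {e : ℕ} (hH : IsMatchingCritical H e)
    (htri : ∀ a b c, H.Adj a b → H.Adj b c → ¬ H.Adj a c) (hP : IsPairing H σ)
    (hσe : (unmatched σ).card = e) {v w : V} (hvw : H.Adj v w) :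
    (∀ u, σ u = u → ¬ H.Adj v u) ∨ ∀ u, σ u = u → ¬ H.Adj w u := by
  by_contra hc
  push Not at hc
  obtain ⟨⟨u, hu, hvu⟩, u', hu', hwu'⟩ := hc
  -- By Gallai's lemma both uncovered neighbours coincide, which gives a triangle.
  obtain rfl := hH.eq_of_reachable (hvu.symm.reachable.trans (hvw.reachable.trans hwu'.reachable))
    hP hσe hu hu'
  exact htri _ _ _ hvw hwu' hvu

/-- The seagull provided by a link: its centre is `c`, its leaves are `a` and `σ a`, and the fourth
vertex `σ c` has no neighbours among the uncovered vertices. -/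
theorem IsLinkage.exists_seagull {e : ℕ} (h : IsLinkage H σ T) (hH : IsMatchingCritical H e)
    (htri : ∀ a b c, H.Adj a b → H.Adj b c → ¬ H.Adj a c)
    (hσe : (unmatched σ).card = e) {p : V × V} (hp : p ∈ T) :
    ∃ c a, OnLink σ p c ∧ OnLink σ p a ∧ a ≠ c ∧ a ≠ σ c ∧ ¬ H.Adj c a ∧ ¬ H.Adj c (σ a) ∧
      ∀ u, σ u = u → ¬ H.Adj (σ c) u := by
  have hP := h.pairing
  obtain ⟨l1, l2, l3⟩ := h.link p hp
  have n1 := h.apply_ne (fst_mem_linkEnds hp)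
  have n2 := h.apply_ne (snd_mem_linkEnds hp)
  have hne := (h.erase_ends hp).2.2.symm
  have hne' : p.2 ≠ σ p.1 := fun e => h.notMem _ (fst_mem_linkEnds hp) (e ▸ snd_mem_linkEnds hp)
  have hne'' : p.1 ≠ σ p.2 := fun e => h.notMem _ (snd_mem_linkEnds hp) (e ▸ fst_mem_linkEnds hp)
  have o1 : OnLink σ p p.1 := Or.inl rfl
  have o2 : OnLink σ p p.2 := Or.inr (Or.inr (Or.inl rfl))
  by_cases h1 : ∀ u, σ u = u → ¬ H.Adj (σ p.1) u
  · exact ⟨p.1, p.2, o1, o2, hne, hne', l1, l2, h1⟩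
  by_cases h2 : ∀ u, σ u = u → ¬ H.Adj (σ p.2) u
  · exact ⟨p.2, p.1, o2, o1, hne.symm, hne'', fun e => l1 e.symm, fun e => l3 e.symm, h2⟩
  -- Now both `σ p.1` and `σ p.2` have uncovered neighbours. Hence they are not adjacent, and `p.1`
  -- has no uncovered neighbour, so `σ p.1` can be the centre.
  refine ⟨σ p.1, p.2, o1.apply hP, o2, hne', by rwa [hP.invol], l3, fun hadj => ?_, ?_⟩
  · rcases hH.apart_or htri hP hσe hadj with h3 | h3
    exacts [h1 h3, h2 h3]
  · rw [hP.invol]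
    exact (hH.apart_or htri hP hσe (hP.adj p.1 n1)).resolve_right h1

/-- A linkage with enough links yields a star model. -/
theorem IsLinkage.hasStarModel {e : ℕ} (h : IsLinkage H σ T) (hH : IsMatchingCritical H e)
    (htri : ∀ a b c, H.Adj a b → H.Adj b c → ¬ H.Adj a c)
    (hσe : (unmatched σ).card = e) {ℓ k : ℕ} (hn : Fintype.card V + e = 2 * k)
    (hT : T.card = ℓ - e) : HasStarModel Hᶜ ℓ (k - ℓ) := by
  classical
  have hP := h.pairing
  -- The singleton stars are uncovered vertices. The minimum matches the truncated `ℓ - e`: no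
  -- seagulls are used if ℓ ≤ e.
  obtain ⟨A, hAU, hA⟩ := exists_subset_card_eq (s := unmatched σ) (n := min ℓ e)
    (by rw [hσe]; exact min_le_right _ _)
  have hfix : ∀ u ∈ unmatched σ, ∀ u' ∈ unmatched σ, ¬ H.Adj u u' := by
    intro u hu u' hu' hadj
    exact hadj.ne (hH.eq_of_reachable hadj.reachable hP hσe (mem_unmatched.1 hu)
      (mem_unmatched.1 hu'))
  have hsea := fun p : T => h.exists_seagull hH htri hσe p.2
  choose c a hc ha hac hac' hadj hadj' hcu using hsea
  have hcn : ∀ p, σ (c p) ≠ c p := fun p => h.onLink_ne p.2 (hc p)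
  have han : ∀ p, σ (a p) ≠ a p := fun p => h.onLink_ne p.2 (ha p)
  let D : Finset V := univ.filter fun v => IsFree σ T v ∧ ∀ u, σ u = u → ¬ H.Adj v u
  have hD : ∀ v, v ∈ D ↔ IsFree σ T v ∧ ∀ u, σ u = u → ¬ H.Adj v u := fun v => by simp [D]
  have hDc : Fintype.card V ≤ (unmatched σ).card + 4 * T.card + 2 * D.card := by
    refine h.card_le fun v hv => ?_
    rw [hD, hD]
    rcases hH.apart_or htri hP hσe (hP.adj v hv.1) with h1 | h1
    · exact Or.inl ⟨hv, h1⟩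
    · exact Or.inr ⟨hv.apply hP, h1⟩
  let E : Finset V := univ.image fun p : T => σ (c p)
  have hEc : E.card = T.card := by
    rw [card_image_of_injective, card_univ, Fintype.card_coe]
    intro p q hpq
    have h1 : c p = c q := σ.injective hpq
    exact Subtype.ext (h.onLink_unique p.2 q.2 (hc p) (h1 ▸ hc q))
  have hE : ∀ v ∈ E, ∃ p, v = σ (c p) := fun v hv => by
    obtain ⟨p, -, rfl⟩ := mem_image.1 hv
    exact ⟨p, rfl⟩
  have hEn : ∀ v ∈ E, σ v ≠ v := by
    intro v hv
    obtain ⟨p, rfl⟩ := hE v hv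
    exact fun e => hcn p (σ.injective e)
  have hd1 : Disjoint (unmatched σ \ A) E := by
    refine Finset.disjoint_left.2 fun v hv hv' => ?_
    exact hEn v hv' (mem_unmatched.1 (mem_sdiff.1 hv).1)
  have hd2 : Disjoint ((unmatched σ \ A) ∪ E) D := by
    refine Finset.disjoint_left.2 fun v hv hv' => ?_
    have hvf := ((hD v).1 hv').1
    rcases mem_union.1 hv with hv | hv
    · exact hvf.1 (mem_unmatched.1 (mem_sdiff.1 hv).1)
    · obtain ⟨p, rfl⟩ := hE v hv
      exact h.not_free_of_onLink p.2 ((hc p).apply hP) hvf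
  -- The set `B` consists of the remaining uncovered vertices, the fourth vertex of every link, and
  -- ends of free matching edges without uncovered neighbours, at least one per edge.
  have hBc : k - ℓ ≤ ((unmatched σ \ A) ∪ E ∪ D).card := by
    rw [card_union_of_disjoint hd2, card_union_of_disjoint hd1]
    have h1 := card_sdiff_add_card_eq_card hAU
    omega
  let S : A ⊕ T → Finset V := Sum.elim (fun _ => ∅) (fun p => {a p, σ (a p)})
  let z : A ⊕ T → V := Sum.elim Subtype.val c
  have hS : ∀ p v, (v = z (Sum.inr p) ∨ v ∈ S (Sum.inr p)) →
      OnLink σ p.1 v ∧ v ≠ σ (c p) := by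
    intro p v hv
    simp only [z, S, Sum.elim_inr, mem_insert, mem_singleton] at hv
    rcases hv with rfl | rfl | rfl
    · exact ⟨hc p, (hcn p).symm⟩
    · exact ⟨ha p, hac' p⟩
    · exact ⟨(ha p).apply hP, fun e => hac p (σ.injective e)⟩
  have hS' : ∀ u v, (v = z (Sum.inl u) ∨ v ∈ S (Sum.inl u)) → v = u := by
    intro u v hv
    simpa [z, S] using hv
  have hAfix : ∀ u : A, σ u = u := fun u => mem_unmatched.1 (hAU u.2)
  refine IsStarModel.hasStarModel (ι := A ⊕ T) (c := z) (S := S) (B := (unmatched σ \ A) ∪ E ∪ D)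
    ⟨?_, ?_, ?_, ?_⟩ ?_ hBc
  · rintro (u | p) s hs
    · simp [S] at hs
    · simp only [S, Sum.elim_inr, mem_insert, mem_singleton] at hs
      change Hᶜ.Adj (c p) s
      rw [compl_adj]
      rcases hs with rfl | rfl
      · exact ⟨(hac p).symm, hadj p⟩
      · exact ⟨fun e => hac' p (by rw [e, hP.invol]), hadj' p⟩
  · rintro (u | p) (u' | q) v hi hj
    · rw [Subtype.ext ((hS' u v hi).symm.trans (hS' u' v hj))]
    · exact absurd (hAfix u) (by rw [← hS' u v hi]; exact h.onLink_ne q.2 (hS q v hj).1)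
    · exact absurd (hAfix u') (by rw [← hS' u' v hj]; exact h.onLink_ne p.2 (hS p v hi).1)
    · rw [Subtype.ext (h.onLink_unique p.2 q.2 (hS p v hi).1 (hS q v hj).1)]
  · rintro (u | p) v hv hB
    · rw [hS' u v hv] at hB
      rcases mem_union.1 hB with hB | hB
      · rcases mem_union.1 hB with hB | hB
        · exact (mem_sdiff.1 hB).2 u.2
        · exact hEn _ hB (hAfix u)
      · exact ((hD _).1 hB).1.1 (hAfix u)
    · obtain ⟨h1, h2⟩ := hS p v hv
      rcases mem_union.1 hB with hB | hB
      · rcases mem_union.1 hB with hB | hB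
        · exact h.onLink_ne p.2 h1 (mem_unmatched.1 (mem_sdiff.1 hB).1)
        · obtain ⟨q, rfl⟩ := hE v hB
          obtain rfl : p = q := Subtype.ext (h.onLink_unique p.2 q.2 h1 ((hc q).apply hP))
          exact h2 rfl
      · exact h.not_free_of_onLink p.2 h1 ((hD v).1 hB).1
  · rintro (u | p) b hb
    · refine Or.inr ⟨rfl, ?_⟩
      change Hᶜ.Adj (u : V) b
      rw [compl_adj]
      rcases mem_union.1 hb with hb | hb
      · rcases mem_union.1 hb with hb | hb
        · rw [mem_sdiff] at hb
          exact ⟨fun e => hb.2 (e ▸ u.2), hfix u (hAU u.2) b hb.1⟩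
        · have h1 := hEn b hb
          obtain ⟨p, rfl⟩ := hE b hb
          exact ⟨fun e => h1 (e ▸ hAfix u), fun e => hcu p u (hAfix u) e.symm⟩
      · obtain ⟨h1, h2⟩ := (hD b).1 hb
        exact ⟨fun e => h1.1 (e ▸ hAfix u), fun e => h2 u (hAfix u) e.symm⟩
    · left
      have hnb : b ≠ a p ∧ b ≠ σ (a p) := by
        have key : ∀ v ∈ S (Sum.inr p), b ≠ v := by
          intro v hv e
          obtain ⟨h1, h2⟩ := hS p v (Or.inr hv)
          subst e
          rcases mem_union.1 hb with hB | hB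
          · rcases mem_union.1 hB with hB | hB
            · exact h.onLink_ne p.2 h1 (mem_unmatched.1 (mem_sdiff.1 hB).1)
            · obtain ⟨q, rfl⟩ := hE b hB
              obtain rfl : p = q := Subtype.ext (h.onLink_unique p.2 q.2 h1 ((hc q).apply hP))
              exact h2 rfl
          · exact h.not_free_of_onLink p.2 h1 ((hD b).1 hB).1
        exact ⟨key _ (by simp [S]), key _ (by simp [S])⟩
      -- The leaves `a p` and `σ (a p)` are adjacent in `H`, so `b` is `H`-adjacent to at most one
      -- of them.
      by_cases h1 : H.Adj (a p) b
      · refine ⟨σ (a p), by simp [S], ?_⟩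
        rw [compl_adj]
        exact ⟨hnb.2.symm, htri _ _ _ (hP.adj (a p) (han p)).symm h1⟩
      · refine ⟨a p, by simp [S], ?_⟩
        rw [compl_adj]
        exact ⟨hnb.1.symm, h1⟩
  · rw [Fintype.card_sum, Fintype.card_coe, Fintype.card_coe, hA, hT]
    omega

theorem IsMatchingCritical.hasStarModel {e : ℕ} (hH : IsMatchingCritical H e)
    (htri : ∀ a b c, H.Adj a b → H.Adj b c → ¬ H.Adj a c) {ℓ k : ℕ}
    (hn : Fintype.card V + e = 2 * k) (he : 1 ≤ e) (hℓk : 2 * ℓ ≤ k) :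
    HasStarModel Hᶜ ℓ (k - ℓ) := by
  classical
  obtain ⟨v⟩ : Nonempty V := by
    rw [← not_isEmpty_iff]
    intro hV
    have := hH.le_card 1 (isPairing_one H)
    simp [unmatched] at this
    omega
  -- The number of links is maximised over all maximum matchings at once, since the exchanges alter
  -- the matching.
  obtain ⟨⟨σ, T⟩, hmem, hmax⟩ := exists_max_image
    (univ.filter fun q : Perm V × Finset (V × V) => IsLinkage H q.1 q.2 ∧
      (unmatched q.1).card = e) (fun q => q.2.card) (by
      obtain ⟨σ, h1, h2, -⟩ := hH.exists_fixed v
      exact ⟨(σ, ∅), by simpa using ⟨⟨h1, by simp, by simp, by simp [linkEnds]⟩, h2⟩⟩)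
  simp only [mem_filter, mem_univ, true_and, Prod.forall] at hmem hmax
  obtain ⟨h, hσe⟩ := hmem
  have hP := h.pairing
  by_cases hT : ℓ - e ≤ T.card
  · obtain ⟨T', hT', hc⟩ := exists_subset_card_eq hT
    exact (h.mono hT').hasStarModel hH htri hσe hn hc
  obtain ⟨A, hA⟩ := h.exists_isFreeSide htri fun T' hT' => hmax σ T' ⟨hT', hσe⟩
  have hAc := h.card_le hA.cover
  -- From |T| ≤ ℓ - e - 1 and 2ℓ ≤ k one gets |A| ≥ k - e - 2|T| ≥ e + 2, and e ≥ 1.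
  have hA3 : 3 ≤ A.card := by omega
  obtain ⟨T', h', hc', hA', hor⟩ := h.exists_oriented htri hA hA3
  have hmax' : ∀ σ' S, IsLinkage H σ' S → (unmatched σ').card = (unmatched σ).card →
      S.card ≤ T'.card := fun σ' S hS hc => by
    rw [hc']; exact hmax σ' S ⟨hS, hc.trans hσe⟩
  have hXc := h'.card_le_extendedSide htri (fun S hS => hmax' σ S hS rfl) hA' hA3
  have hsplit := card_filter_add_card_filter_not (s := T') (fun p =>
    p.1 ∈ extendedSide H σ A ∧ σ p.2 ∈ extendedSide H σ A)
  change (sideLinks H σ A T').card + _ = _ at hsplit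
  rcases exists_matching_or_unrelated (fun x y => ¬ H.Adj x y) (extendedSide H σ A)
    ((extendedSide H σ A).map σ.toEmbedding) (sideLinks H σ A T').card with
    ⟨F, hFc, hF, hF1, hF2⟩ | ⟨X, -, Y, -, hXY, hX, hY⟩
  · exact absurd hFc (h'.card_ne_of_maximal htri hmax' hA' hA3 hor hF hF1 hF2)
  · rw [card_map] at hY
    have hXY' : ∀ x ∈ X, ∀ y ∈ Y, H.Adj x y := fun x hx y hy => not_not.1 (hXY x hx y hy)
    -- Both sets have at least k - e - |T'| ≥ k - ℓ + 1 > ℓ elements.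
    exact hH.hasStarModel_of_complete htri hP hσe hn hXY' (card_pos.1 (by omega))
      (card_pos.1 (by omega)) (by omega) (by omega)

end SimpleGraph

/-! ### Reduction to the matching-critical case and conclusion -/

namespace SimpleGraph

open Finset Equiv

/-- A graph without independent sets of size three in which no matching of the complement has more
than `card V - k` edges has a star model on `k` branch sets. -/
theorem hasStarModel_of_forall_pairing (n : ℕ) : ∀ {V : Type*} [Fintype V] [DecidableEq V]
    (G : SimpleGraph V), Fintype.card V = n →
    (∀ a b c, Gᶜ.Adj a b → Gᶜ.Adj b c → ¬ Gᶜ.Adj a c) → ∀ (ℓ k : ℕ), 2 * ℓ ≤ k →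
    (∀ σ, IsPairing Gᶜ σ → 2 * k ≤ Fintype.card V + (unmatched σ).card) →
    HasStarModel G ℓ (k - ℓ) := by
  induction n with
  | zero =>
    intro V _ _ G hn htri ℓ k hℓk hσ
    have h1 := hσ 1 (isPairing_one _)
    have h2 := card_le_univ (unmatched (1 : Perm V))
    obtain rfl : ℓ = 0 := by omega
    obtain rfl : k = 0 := by omega
    exact ⟨Fin.elim0, Fin.elim0, ∅, rfl, ⟨fun i => i.elim0, fun i => i.elim0, fun i => i.elim0,
      fun i => i.elim0⟩⟩
  | succ n ih =>
    intro V _ _ G hn htri ℓ k hℓk hσ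
    by_cases hv : ∃ v, ∀ σ, IsPairing Gᶜ σ → σ v = v →
        2 * k + 2 ≤ Fintype.card V + (unmatched σ).card
    -- Such a `v` can be deleted: a matching of the rest also misses `v` in the whole graph, so the
    -- order and the number of missed vertices each drop by one.
    · obtain ⟨v, hv⟩ := hv
      let f : {w // w ≠ v} ↪ V := Function.Embedding.subtype _
      have hcard : Fintype.card {w // w ≠ v} = n := by
        rw [Fintype.card_subtype_compl, Fintype.card_subtype_eq, hn]; rfl
      refine HasStarModel.map (G := G.comap f) (ih (G.comap f) hcard ?_ ℓ k hℓk ?_)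
        (Embedding.comap f G)
      · intro a b c hab hbc hac
        simp only [compl_adj, comap_adj, ne_eq] at hab hbc hac
        refine htri a b c ?_ ?_ ?_ <;> rw [compl_adj]
        · exact ⟨fun e => hab.1 (Subtype.ext e), hab.2⟩
        · exact ⟨fun e => hbc.1 (Subtype.ext e), hbc.2⟩
        · exact ⟨fun e => hac.1 (Subtype.ext e), hac.2⟩
      · intro σ hσP
        have hof : ∀ w : {w // w ≠ v}, Perm.ofSubtype σ (w : V) = σ w := fun w =>
          Perm.ofSubtype_apply_coe σ w
        have hofv : Perm.ofSubtype σ v = v := Perm.ofSubtype_apply_of_not_mem σ (by simp)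
        have hP : IsPairing Gᶜ (Perm.ofSubtype σ) := by
          constructor
          · intro w
            by_cases hw : w = v
            · rw [hw, hofv, hofv]
            · rw [hof ⟨w, hw⟩, hof, hσP.invol]
          · intro w hw
            by_cases hwv : w = v
            · rw [hwv] at hw; exact absurd hofv hw
            · rw [hof ⟨w, hwv⟩] at hw ⊢
              have h1 := hσP.adj ⟨w, hwv⟩ fun e => hw (congrArg Subtype.val e)
              rw [compl_adj] at h1 ⊢
              exact ⟨fun e => h1.1 (Subtype.ext e), h1.2⟩
        have h1 := hv _ hP hofv
        have h2 : unmatched (Perm.ofSubtype σ) = insert v ((unmatched σ).map f) := by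
          ext w
          simp only [mem_unmatched, mem_insert, mem_map]
          constructor
          · intro hw
            by_cases hwv : w = v
            · exact Or.inl hwv
            · refine Or.inr ⟨⟨w, hwv⟩, ?_, rfl⟩
              rw [hof ⟨w, hwv⟩] at hw
              exact Subtype.ext hw
          · rintro (rfl | ⟨w, hw, rfl⟩)
            · exact hofv
            · change Perm.ofSubtype σ (w : V) = w
              rw [hof, hw]
        have h3 := card_insert_le v ((unmatched σ).map f)
        rw [← h2, card_map] at h3
        omega
    · push Not at hv
      have hcrit : IsMatchingCritical Gᶜ (2 * k - Fintype.card V) := by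
        refine ⟨fun σ h => ?_, fun v => ?_⟩
        · have := hσ σ h
          omega
        · obtain ⟨σ, h1, h2, h3⟩ := hv v
          refine ⟨σ, h1, ?_, h2⟩
          -- The sum of the order and the number of missed vertices is even, at least `2 * k` and
          -- less than `2 * k + 2`.
          have h4 := hσ σ h1
          obtain ⟨a, ha⟩ := h1.even_card_add
          omega
      obtain ⟨v⟩ : Nonempty V := Fintype.card_pos_iff.1 (by omega)
      obtain ⟨σ, h1, h2, h3⟩ := hcrit.exists_fixed v
      have h4 : 0 < (unmatched σ).card := card_pos.2 ⟨v, by simpa using h3⟩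
      have := hcrit.hasStarModel htri (ℓ := ℓ) (k := k) (by omega) (by omega) hℓk
      rwa [compl_compl] at this

theorem hasStarModel_of_indepNum_le_two {V : Type*} [Finite V] (G : SimpleGraph V)
    (hα : G.indepNum ≤ 2) {k : ℕ} (hk : G.chromaticNumber = (k : ℕ∞)) {ℓ : ℕ} (hℓk : 2 * ℓ ≤ k) :
    HasStarModel G ℓ (k - ℓ) := by
  classical
  have := Fintype.ofFinite V
  refine hasStarModel_of_forall_pairing _ G rfl ?_ ℓ k hℓk ?_
  · intro a b c hab hbc hac
    have hI : G.IsIndepSet (({a, b, c} : Finset V) : Set V) := by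
      rw [← isClique_compl, coe_insert, coe_insert, coe_singleton, isClique_insert,
        isClique_insert]
      refine ⟨⟨Set.pairwise_singleton _ _, ?_⟩, ?_⟩
      · rintro x rfl -
        exact hbc
      · rintro x (rfl | rfl) -
        exacts [hab, hac]
    have h1 := hI.card_le_indepNum
    rw [card_eq_three.2 ⟨a, b, c, hab.ne, hac.ne, hbc.ne, rfl⟩] at h1
    omega
  · intro σ hσ
    obtain ⟨m, hm⟩ := hσ.even_card_add
    have h1 := (hσ.colorable (k := m) (by omega)).chromaticNumber_le
    rw [hk, Nat.cast_le] at h1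
    omega

/-- Exchanging the sides of a complete bipartite graph. -/
def completeBipartiteGraphSwap (α β : Type*) :
    completeBipartiteGraph α β ≃g completeBipartiteGraph β α where
  toEquiv := Equiv.sumComm α β
  map_rel_iff' := by
    rintro (a | a) (b | b) <;> simp

end SimpleGraph

theorem theorem2 {V : Type*} [Finite V] (G : SimpleGraph V) (hα : G.indepNum ≤ 2)
    (k : ℕ) (hk : G.chromaticNumber = (k : ℕ∞)) (ℓ : ℕ) (hℓ : 1 ≤ ℓ) (hℓk : ℓ < k) :
    SimpleGraph.IsOddMinor (completeBipartiteGraph (Fin ℓ) (Fin (k - ℓ))) G := by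
  -- Otherwise the roles of `ℓ` and `k - ℓ` are exchanged.
  by_cases h : 2 * ℓ ≤ k
  · exact (SimpleGraph.hasStarModel_of_indepNum_le_two G hα hk h).isOddMinor
  · have h1 := (SimpleGraph.hasStarModel_of_indepNum_le_two G hα hk (ℓ := k - ℓ)
      (by omega)).isOddMinor
    rw [Nat.sub_sub_self hℓk.le] at h1
    exact h1.of_iso (SimpleGraph.completeBipartiteGraphSwap _ _)
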